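/- Let $n$ be a positive even integer, $\varepsilon=e^{2\pi i/n}$, and let $\mathbb D_n\subset \mathrm{SL}_2(\mathbb C)$ be the dicyclic group of order $2n$ generated by $$g=\begin{pmatrix}\varepsilon&0\\0&\varepsilon^{-1}\end{pmatrix},\qquad h=\begin{pmatrix}0&1\\-1&0\end{pmatrix},$$ with cyclic subgroup $C_n=\langle g\rangle$. Let $\mathbb D_n$ act on the free algebra $\mathbb C\langle x,y\rangle$ by linear substitutions of the generators (the natural action on $\mathbb Cx\oplus\mathbb Cy\cong\mathbb C^2$), let $\mathbb C\langle x,y\rangle\#\mathbb D_n$ be the skew group algebra, and for $c$ in the centre $Z(\mathbb C[\mathbb D_n])$ of the group algebra put $$H_c=(\mathbb C\langle x,y\rangle\#\mathbb D_n)/(xy-yx-c).$$ A trace on $H_c$ is a $\mathbb C$-linear map $T\colon H_c\to\mathbb C$ with $T(ab)=T(ba)$ for all $a,b\in H_c$. Proposition. Let $c\in Z(\mathbb C[\mathbb D_n])\cap\mathbb C[C_n]$ have nonzero coefficient at the group identity; this holds in particular for every generic $c\in\mathbb C[C_n]$. Then the complex vector space of traces on $H_c$ has dimension $\frac n2+2$.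 -/

import Mathlib

noncomputable section

open scoped MatrixGroups

namespace KleinianD

/-- The free algebra `ℂ⟨x, y⟩` on two generators. -/
abbrev FreeXY : Type := FreeAlgebra ℂ (Fin 2)

/-- The generator `x` of `ℂ⟨x, y⟩`. -/
def X : FreeXY := FreeAlgebra.ι ℂ 0

/-- The generator `y` of `ℂ⟨x, y⟩`. -/
def Y : FreeXY := FreeAlgebra.ι ℂ 1

/-- The algebra endomorphism of `ℂ⟨x, y⟩` induced by a matrix `M`, regarded as an operator on the
span of the generators: it sends the `j`-th generator to `∑ i, M i j • (i-th generator)`. -/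
def subst (M : Matrix (Fin 2) (Fin 2) ℂ) : FreeXY →ₐ[ℂ] FreeXY :=
  FreeAlgebra.lift ℂ fun j => ∑ i, M i j • FreeAlgebra.ι ℂ i

theorem subst_ι (M : Matrix (Fin 2) (Fin 2) ℂ) (j : Fin 2) :
    subst M (FreeAlgebra.ι ℂ j) = ∑ i, M i j • FreeAlgebra.ι ℂ i :=
  FreeAlgebra.lift_ι_apply _ _

theorem subst_one : subst 1 = AlgHom.id ℂ FreeXY := by
  apply FreeAlgebra.hom_ext
  funext j
  fin_cases j <;> simp [subst_ι]

theorem subst_mul (M N : Matrix (Fin 2) (Fin 2) ℂ) :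
    subst (M * N) = (subst M).comp (subst N) := by
  apply FreeAlgebra.hom_ext
  funext j
  simp only [Function.comp_apply, AlgHom.comp_apply, subst_ι, Matrix.mul_apply,
    Fin.sum_univ_two, map_add, map_smul, smul_add, smul_smul, add_smul]
  rw [mul_comm (M 0 0), mul_comm (M 0 1), mul_comm (M 1 0), mul_comm (M 1 1)]
  abel

/-- The standard left action of `SL(2, ℂ)` on `ℂ⟨x, y⟩` by linear substitutions. Subgroups of
`SL(2, ℂ)` act by restriction. -/
instance : MulSemiringAction SL(2, ℂ) FreeXY where
  smul M P := subst M.1 P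
  one_smul P := by
    change subst (1 : SL(2, ℂ)).1 P = P
    rw [Matrix.SpecialLinearGroup.coe_one, subst_one]; rfl
  mul_smul M N P := by
    change subst (M * N : SL(2, ℂ)).1 P = subst M.1 (subst N.1 P)
    rw [Matrix.SpecialLinearGroup.coe_mul, subst_mul]; rfl
  smul_zero M := map_zero (subst M.1)
  smul_add M := map_add (subst M.1)
  smul_one M := map_one (subst M.1)
  smul_mul M := map_mul (subst M.1)

theorem smul_def (M : SL(2, ℂ)) (P : FreeXY) : M • P = subst M.1 P := rfl

instance : SMulCommClass SL(2, ℂ) ℂ FreeXY where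
  smul_comm M z P := by simp only [smul_def, map_smul]

instance (G : Subgroup SL(2, ℂ)) : SMulCommClass G ℂ FreeXY where
  smul_comm M z P := smul_comm (M : SL(2, ℂ)) z P

/-- The skew group algebra `ℂ⟨x, y⟩ # G`: its underlying space is `ℂ⟨x, y⟩ ⊗ ℂ[G]`, with
`(P ⊗ g) (Q ⊗ h) = P (g • Q) ⊗ g h`; the element `P ⊗ g` is `SkewMonoidAlgebra.single g P`. -/
abbrev Skew (G : Subgroup SL(2, ℂ)) : Type := SkewMonoidAlgebra FreeXY G

/-- The inclusion of the group algebra `ℂ[G]` in the skew group algebra. -/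
def groupIncl (G : Subgroup SL(2, ℂ)) : MonoidAlgebra ℂ G →ₐ[ℂ] Skew G :=
  MonoidAlgebra.lift ℂ (Skew G) G (SkewMonoidAlgebra.of FreeXY G)

/-- The single defining relation `x y - y x = c`. -/
inductive Rel (G : Subgroup SL(2, ℂ)) (c : MonoidAlgebra ℂ G) : Skew G → Skew G → Prop
  | comm : Rel G c (SkewMonoidAlgebra.single 1 (X * Y - Y * X)) (groupIncl G c)

/-- The algebra `H_c = (ℂ⟨x, y⟩ # G) / (x y - y x - c)`, the quotient by the two-sided ideal
generated by `x y - y x - c`. -/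
abbrev H (G : Subgroup SL(2, ℂ)) (c : MonoidAlgebra ℂ G) : Type := RingQuot (Rel G c)

/-- The space of traces on a complex algebra: linear functionals `T` with `T (a b) = T (b a)`. -/
def traces (A : Type*) [Ring A] [Algebra ℂ A] : Submodule ℂ (A →ₗ[ℂ] ℂ) where
  carrier := {T | ∀ a b : A, T (a * b) = T (b * a)}
  zero_mem' := by intro a b; simp
  add_mem' := by
    intro S T hS hT a b
    simp only [LinearMap.add_apply]
    rw [hS a b, hT a b]
  smul_mem' := by
    intro z T hT a b
    simp only [LinearMap.smul_apply]
    rw [hT a b]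

/-- `ε = exp (2 π i / n)`. -/
def eps (n : ℕ) : ℂ := Complex.exp (2 * Real.pi * Complex.I / n)

/-- The matrix `g = diag (ε, ε⁻¹)`. -/
def gMat (n : ℕ) : SL(2, ℂ) :=
  ⟨!![eps n, 0; 0, (eps n)⁻¹], by
    have h : eps n ≠ 0 := Complex.exp_ne_zero _
    rw [Matrix.det_fin_two_of, mul_inv_cancel₀ h]; simp⟩

/-- The matrix `h = [[0, 1], [-1, 0]]`. -/
def hMat : SL(2, ℂ) :=
  ⟨!![0, 1; -1, 0], by rw [Matrix.det_fin_two_of]; simp⟩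

/-- The dicyclic group `𝔻_n` (for even `n > 0`, of order `2 n`) generated by `g` and `h`. -/
def dicyclic (n : ℕ) : Subgroup SL(2, ℂ) := Subgroup.closure {gMat n, hMat}

end KleinianD

end

/-!
A trace on `H_c` is determined by its values on the nontrivial elements of the dicyclic group, and
these values may be any function that is constant on conjugacy classes. There are `n / 2 + 2`
classes of nontrivial elements, represented by `g, …, g ^ (n / 2)` and `h, g h`.

*Uniqueness* (`trace_eq_zero`) holds for any finite or infinite subgroup of `SL(2, ℂ)` in which no
nontrivial element has the eigenvalue `1`. Let a trace `T` vanish on the nontrivial group elements.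
One shows `T (P γ) = 0` for products `P` of `d` vectors by induction on `d`. For `γ ≠ 1`, moving a
vector `v` of `P` around the trace replaces it by `γ v`, up to terms with fewer vectors, and `1 - γ`
is invertible. For `γ = 1`, the identity `T [x, y P] = T [y, x P]` becomes `(d + 2) c₁ T P = 0` up
to terms that are already known to vanish, and the coefficient `c₁` of `c` at the identity is
nonzero.

*Existence* uses representations induced from weight modules of the subalgebra generated by `x, y,
g`, with one-dimensional weight spaces indexed by `ℤ`. The values at `h` and `g h` are obtained from
the two modules that `h` maps to themselves: `h` reverses the weights, so the matrix of `a h` for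
`a` in that subalgebra has finitely many nonzero diagonal entries, and its trace makes sense
(`exists_trace_antidiagonal`). The values at powers of `g` come from the family of modules with a
parameter `s`. There the sum of the diagonal entries diverges, but these entries are polynomials in
`s`, and the translation of the index by `n` translates `s` by `n c₁`. The sum over one period, with
the entries evaluated by functionals on `ℂ[s]` that jump by multiples of evaluations at the points
where the module becomes reducible, is a trace (`exists_trace_diagonal`). The values of these
functionals on constants are free up to a common summand, because the periodic polynomials are the
constants.
-/

open scoped MatrixGroups

noncomputable section

namespace KleinianD

/-! ### Traces that vanish on the nontrivial group elements -/

section Vanishing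

variable {A : Type*} [Ring A] [Algebra ℂ A] {G : Subgroup SL(2, ℂ)}

/-- Elements of a `ℂ`-algebra `A` that satisfy the defining relations of `H_c`: a linear map `vec`
from the span of the generators, coordinates being those with respect to `x, y`, and a homomorphism
`grp` from the group, such that `γ v = γ(v) γ` and `[v, w] = ω(v, w) c`. Here `ω` is the
determinant, so that the second relation amounts to `x y - y x = c`. -/
structure Realization (G : Subgroup SL(2, ℂ)) (c : MonoidAlgebra ℂ G) (A : Type*) [Ring A]
    [Algebra ℂ A] where
  vec : (Fin 2 → ℂ) →ₗ[ℂ] A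
  grp : G →* A
  grp_mul_vec : ∀ (γ : G) (a : Fin 2 → ℂ),
    grp γ * vec a = vec ((γ : SL(2, ℂ)).1.mulVec a) * grp γ
  comm : ∀ a b : Fin 2 → ℂ, vec a * vec b - vec b * vec a =
    (a 0 * b 1 - a 1 * b 0) • MonoidAlgebra.lift ℂ A G grp c

namespace Realization

variable {c : MonoidAlgebra ℂ G} (ρ : Realization G c A)

/-- The span `V` of `x` and `y` in `A`. -/
def vecs : Submodule ℂ A := LinearMap.range ρ.vec

/-- The image `ℂ[G]` of the group algebra in `A`. -/
def grps : Submodule ℂ A := Submodule.span ℂ (Set.range ρ.grp)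

/-- The span of the nontrivial group elements in `A`. -/
def nontrivGrps : Submodule ℂ A := Submodule.span ℂ (ρ.grp '' {γ | γ ≠ 1})

/-- The span of the products of `d` vectors and one group element. -/
def layer (d : ℕ) : Submodule ℂ A := ρ.vecs ^ d * ρ.grps

/-- The span of the products of fewer than `d` vectors and one group element. -/
def low (d : ℕ) : Submodule ℂ A := ⨆ i, ⨆ _ : i < d, ρ.layer i

/-- The image of `c` in `A`, which is the commutator of `x` and `y`. -/
def rel : A := MonoidAlgebra.lift ℂ A G ρ.grp c

theorem vec_mem (a : Fin 2 → ℂ) : ρ.vec a ∈ ρ.vecs := ⟨a, rfl⟩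

theorem grp_mem (γ : G) : ρ.grp γ ∈ ρ.grps := Submodule.subset_span ⟨γ, rfl⟩

theorem rel_mem : ρ.rel ∈ ρ.grps := by
  rw [rel, MonoidAlgebra.lift_apply]
  exact Submodule.sum_mem _ fun γ _ => Submodule.smul_mem _ _ (ρ.grp_mem γ)

theorem rel_sub_mem : ρ.rel - c.coeff 1 • 1 ∈ ρ.nontrivGrps := by
  classical
  rw [rel, MonoidAlgebra.lift_apply, Finsupp.sum]
  by_cases h1 : (1 : G) ∈ c.coeff.support
  · rw [← Finset.add_sum_erase _ _ h1, map_one ρ.grp, add_sub_cancel_left]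
    refine Submodule.sum_mem _ fun γ hγ => Submodule.smul_mem _ _ (Submodule.subset_span ?_)
    exact ⟨γ, Finset.ne_of_mem_erase hγ, rfl⟩
  · rw [Finsupp.notMem_support_iff.1 h1, zero_smul, sub_zero]
    refine Submodule.sum_mem _ fun γ hγ => Submodule.smul_mem _ _ (Submodule.subset_span ?_)
    exact ⟨γ, fun h => h1 (h ▸ hγ), rfl⟩

theorem grps_mul_grps : ρ.grps * ρ.grps ≤ ρ.grps := by
  rw [grps, Submodule.span_mul_span]
  refine Submodule.span_mono ?_
  rintro _ ⟨_, ⟨γ, rfl⟩, _, ⟨δ, rfl⟩, rfl⟩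
  exact ⟨γ * δ, map_mul _ _ _⟩

theorem span_grp_mul_vecs (S : Set G) :
    Submodule.span ℂ (ρ.grp '' S) * ρ.vecs ≤ ρ.vecs * Submodule.span ℂ (ρ.grp '' S) := by
  rw [Submodule.mul_le]
  rintro m hm _ ⟨a, rfl⟩
  induction hm using Submodule.span_induction with
  | mem m hm =>
    obtain ⟨γ, hγ, rfl⟩ := hm
    rw [ρ.grp_mul_vec]
    exact Submodule.mul_mem_mul (ρ.vec_mem _) (Submodule.subset_span ⟨γ, hγ, rfl⟩)
  | zero => simp
  | add m m' _ _ h h' => rw [add_mul]; exact add_mem h h'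
  | smul z m _ h => rw [smul_mul_assoc]; exact Submodule.smul_mem _ _ h

theorem span_grp_mul_pow (S : Set G) (d : ℕ) :
    Submodule.span ℂ (ρ.grp '' S) * ρ.vecs ^ d ≤ ρ.vecs ^ d * Submodule.span ℂ (ρ.grp '' S) := by
  induction d with
  | zero => simp
  | succ d ih =>
    calc _ = (Submodule.span ℂ (ρ.grp '' S) * ρ.vecs ^ d) * ρ.vecs := by rw [pow_succ, mul_assoc]
      _ ≤ (ρ.vecs ^ d * Submodule.span ℂ (ρ.grp '' S)) * ρ.vecs := mul_le_mul_left ih _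
      _ = ρ.vecs ^ d * (Submodule.span ℂ (ρ.grp '' S) * ρ.vecs) := mul_assoc _ _ _
      _ ≤ ρ.vecs ^ d * (ρ.vecs * Submodule.span ℂ (ρ.grp '' S)) :=
          mul_le_mul_right (ρ.span_grp_mul_vecs S) _
      _ = _ := by rw [pow_succ, mul_assoc]

theorem grps_mul_layer (d : ℕ) : ρ.grps * ρ.layer d ≤ ρ.layer d := by
  have h := ρ.span_grp_mul_pow Set.univ d
  rw [Set.image_univ] at h
  calc ρ.grps * ρ.layer d = (ρ.grps * ρ.vecs ^ d) * ρ.grps := (mul_assoc _ _ _).symm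
    _ ≤ (ρ.vecs ^ d * ρ.grps) * ρ.grps := mul_le_mul_left h _
    _ = ρ.vecs ^ d * (ρ.grps * ρ.grps) := mul_assoc _ _ _
    _ ≤ ρ.layer d := mul_le_mul_right ρ.grps_mul_grps _

theorem layer_mul_grps (d : ℕ) : ρ.layer d * ρ.grps ≤ ρ.layer d := by
  rw [layer, mul_assoc]
  exact mul_le_mul_right ρ.grps_mul_grps _

theorem vecs_mul_layer (d : ℕ) : ρ.vecs * ρ.layer d = ρ.layer (d + 1) := by
  rw [layer, layer, pow_succ', mul_assoc]

theorem layer_le_low {i d : ℕ} (h : i < d) : ρ.layer i ≤ ρ.low d :=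
  le_iSup₂_of_le i h le_rfl

theorem low_mono {i d : ℕ} (h : i ≤ d) : ρ.low i ≤ ρ.low d :=
  iSup₂_le fun _ hj => ρ.layer_le_low (hj.trans_le h)

theorem grps_mul_low (d : ℕ) : ρ.grps * ρ.low d ≤ ρ.low d := by
  simp only [low, Submodule.mul_iSup]
  exact iSup₂_mono fun i _ => ρ.grps_mul_layer i

theorem low_mul_grps (d : ℕ) : ρ.low d * ρ.grps ≤ ρ.low d := by
  simp only [low, Submodule.iSup_mul]
  exact iSup₂_mono fun i _ => ρ.layer_mul_grps i

theorem vecs_mul_low (d : ℕ) : ρ.vecs * ρ.low d ≤ ρ.low (d + 1) := by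
  rw [low]
  simp only [Submodule.mul_iSup, vecs_mul_layer]
  exact iSup₂_le fun i hi => ρ.layer_le_low (Nat.succ_lt_succ hi)

theorem comm_mem_grps {v w : A} (hv : v ∈ ρ.vecs) (hw : w ∈ ρ.vecs) : v * w - w * v ∈ ρ.grps := by
  obtain ⟨a, rfl⟩ := hv
  obtain ⟨b, rfl⟩ := hw
  rw [ρ.comm]
  exact Submodule.smul_mem _ _ ρ.rel_mem

theorem grps_mul_pow_le_layer (d : ℕ) : ρ.grps * ρ.vecs ^ d ≤ ρ.layer d := by
  have h := ρ.span_grp_mul_pow Set.univ d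
  rwa [Set.image_univ] at h

theorem pow_induction {Q : ℕ → A → Prop} (hone : Q 0 1)
    (hmul : ∀ d v P, v ∈ ρ.vecs → P ∈ ρ.vecs ^ d → Q d P → Q (d + 1) (v * P))
    (hadd : ∀ d P P', Q d P → Q d P' → Q d (P + P'))
    (hsmul : ∀ d (z : ℂ) P, Q d P → Q d (z • P)) {d : ℕ} {P : A} (hP : P ∈ ρ.vecs ^ d) : Q d P := by
  induction d generalizing P with
  | zero =>
    rw [pow_zero] at hP
    obtain ⟨z, rfl⟩ := Submodule.mem_one.1 hP
    rw [Algebra.algebraMap_eq_smul_one]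
    exact hsmul _ _ _ hone
  | succ d ih =>
    rw [pow_succ'] at hP
    induction hP using Submodule.mul_induction_on' with
    | mem_mul_mem v hv P hP => exact hmul d v P hv hP (ih hP)
    | add P _ P' _ h h' => exact hadd _ _ _ h h'

/-- Moving a vector past a product of `d` vectors costs terms with fewer vectors. -/
theorem comm_mem_low {v : A} (hv : v ∈ ρ.vecs) {d : ℕ} {P : A} (hP : P ∈ ρ.vecs ^ d) :
    v * P - P * v ∈ ρ.low d := by
  refine ρ.pow_induction (Q := fun d P => v * P - P * v ∈ ρ.low d) ?_ ?_ ?_ ?_ hP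
  · simp
  · intro d w P hw hP ih
    have h : v * (w * P) - w * P * v = (v * w - w * v) * P + w * (v * P - P * v) := by noncomm_ring
    rw [h]
    refine add_mem (ρ.layer_le_low d.lt_succ_self (ρ.grps_mul_pow_le_layer d ?_))
      (ρ.vecs_mul_low d (Submodule.mul_mem_mul hw ih))
    exact Submodule.mul_mem_mul (ρ.comm_mem_grps hv hw) hP
  · intro d P P' h h'
    have e : v * (P + P') - (P + P') * v = (v * P - P * v) + (v * P' - P' * v) := by noncomm_ring
    rw [e]
    exact add_mem h h'
  · intro d z P h
    rw [mul_smul_comm, smul_mul_assoc, ← smul_sub]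
    exact Submodule.smul_mem _ _ h

/-- The image of the first generator. -/
def x : A := ρ.vec ![1, 0]

/-- The image of the second generator. -/
def y : A := ρ.vec ![0, 1]

theorem x_mem : ρ.x ∈ ρ.vecs := ρ.vec_mem _

theorem y_mem : ρ.y ∈ ρ.vecs := ρ.vec_mem _

theorem vec_eq (a : Fin 2 → ℂ) : ρ.vec a = a 0 • ρ.x + a 1 • ρ.y := by
  rw [x, y, ← map_smul, ← map_smul, ← map_add]
  congr 1
  funext i
  fin_cases i <;> simp

theorem x_comm (a : Fin 2 → ℂ) : ρ.x * ρ.vec a - ρ.vec a * ρ.x = a 1 • ρ.rel := by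
  rw [x, ρ.comm]
  simp [rel]

theorem y_comm (a : Fin 2 → ℂ) : ρ.y * ρ.vec a - ρ.vec a * ρ.y = -(a 0 • ρ.rel) := by
  rw [y, ρ.comm]
  simp [rel]

/-- An Euler identity: `P ↦ y [x, P] - x [y, P]` acts on products of `d` vectors as the scalar
`c₁ d`, up to terms that contain a nontrivial group element or fewer vectors. -/
theorem euler {d : ℕ} {P : A} (hP : P ∈ ρ.vecs ^ d) :
    ρ.y * (ρ.x * P - P * ρ.x) - ρ.x * (ρ.y * P - P * ρ.y) - (d * c.coeff 1 : ℂ) • P ∈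
      ρ.vecs ^ d * ρ.nontrivGrps ⊔ ρ.low d := by
  refine ρ.pow_induction (Q := fun d P => ρ.y * (ρ.x * P - P * ρ.x) - ρ.x * (ρ.y * P - P * ρ.y) -
    (d * c.coeff 1 : ℂ) • P ∈ ρ.vecs ^ d * ρ.nontrivGrps ⊔ ρ.low d) ?_ ?_ ?_ ?_ hP
  · simp
  · rintro d _ P ⟨a, rfl⟩ hP ih
    have h1 : ρ.y * (ρ.x * ρ.vec a - ρ.vec a * ρ.x) - ρ.x * (ρ.y * ρ.vec a - ρ.vec a * ρ.y) =
        ρ.vec a * ρ.rel := by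
      rw [x_comm, y_comm, vec_eq, add_mul, smul_mul_assoc, smul_mul_assoc, mul_neg, mul_smul_comm,
        mul_smul_comm, sub_neg_eq_add, add_comm]
    -- the Leibniz rule for `P ↦ y [x, P] - x [y, P]` on the product `v P`
    have h2 : ρ.y * (ρ.x * (ρ.vec a * P) - ρ.vec a * P * ρ.x) -
        ρ.x * (ρ.y * (ρ.vec a * P) - ρ.vec a * P * ρ.y) - ((d + 1 : ℕ) * c.coeff 1 : ℂ) •
          (ρ.vec a * P) =
        ρ.vec a * ((ρ.rel - c.coeff 1 • 1) * P) +
        ρ.vec a * (ρ.y * (ρ.x * P - P * ρ.x) - ρ.x * (ρ.y * P - P * ρ.y) -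
          (d * c.coeff 1 : ℂ) • P) +
        ((ρ.y * ρ.vec a - ρ.vec a * ρ.y) * (ρ.x * P - P * ρ.x) -
        (ρ.x * ρ.vec a - ρ.vec a * ρ.x) * (ρ.y * P - P * ρ.y)) := by
      have h3 : ρ.vec a * ((ρ.rel - c.coeff 1 • 1) * P) = (ρ.vec a * ρ.rel) * P -
          c.coeff 1 • (ρ.vec a * P) := by
        rw [sub_mul, mul_sub, smul_mul_assoc, one_mul, mul_smul_comm, mul_assoc]
      rw [h3, ← h1, mul_sub (ρ.vec a) _ ((d * c.coeff 1 : ℂ) • P), mul_smul_comm, Nat.cast_succ,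
        add_mul, one_mul, add_smul]
      noncomm_ring
    rw [h2]
    refine add_mem (add_mem ?_ ?_) ?_
    · refine Submodule.mem_sup_left ?_
      rw [pow_succ', mul_assoc]
      exact Submodule.mul_mem_mul (ρ.vec_mem a) (ρ.span_grp_mul_pow _ d
        (Submodule.mul_mem_mul ρ.rel_sub_mem hP))
    · have h := Submodule.mul_mem_mul (ρ.vec_mem a) ih
      rw [Submodule.mul_sup, ← mul_assoc, ← pow_succ'] at h
      exact sup_le_sup_left (ρ.vecs_mul_low d) _ h
    · refine Submodule.mem_sup_right (ρ.low_mono d.le_succ (sub_mem ?_ ?_))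
      · exact ρ.grps_mul_low d (Submodule.mul_mem_mul (ρ.comm_mem_grps ρ.y_mem (ρ.vec_mem a))
          (ρ.comm_mem_low ρ.x_mem hP))
      · exact ρ.grps_mul_low d (Submodule.mul_mem_mul (ρ.comm_mem_grps ρ.x_mem (ρ.vec_mem a))
          (ρ.comm_mem_low ρ.y_mem hP))
  · intro d P P' h h'
    convert add_mem h h' using 1
    rw [smul_add]
    noncomm_ring
  · intro d z P h
    convert Submodule.smul_mem _ z h using 1
    simp only [mul_smul_comm, smul_mul_assoc, smul_sub, mul_sub, smul_comm z]

variable (T : A →ₗ[ℂ] ℂ)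

/-- A trace that vanishes on shorter products and on nontrivial group elements vanishes on
`P γ`, for `P` a product of `d` vectors and `γ ≠ 1`: moving one vector `v` of `P` around the trace
replaces it by `γ v`, and `1 - γ` is invertible. -/
theorem trace_pow_mul_nontrivGrps_eq_zero (hT : ∀ a b, T (a * b) = T (b * a))
    (hG : ∀ γ : G, γ ≠ 1 → (1 - (γ : SL(2, ℂ)).1).det ≠ 0)
    (hT1 : ∀ γ : G, γ ≠ 1 → T (ρ.grp γ) = 0) {d : ℕ} (hlow : ∀ a ∈ ρ.low d, T a = 0) :
    ∀ a ∈ ρ.vecs ^ d * ρ.nontrivGrps, T a = 0 := by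
  suffices h : ∀ γ : G, γ ≠ 1 → ∀ P ∈ ρ.vecs ^ d, T (P * ρ.grp γ) = 0 by
    suffices h' : ρ.vecs ^ d * ρ.nontrivGrps ≤ LinearMap.ker T from fun a ha => h' ha
    rw [Submodule.mul_le]
    intro P hP m hm
    induction hm using Submodule.span_induction with
    | mem m hm =>
      obtain ⟨γ, hγ, rfl⟩ := hm
      exact h γ hγ P hP
    | zero => simp
    | add m m' _ _ h h' => rw [mul_add]; exact add_mem h h'
    | smul z m _ h => rw [mul_smul_comm]; exact Submodule.smul_mem _ _ h
  intro γ hγ P hP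
  cases d with
  | zero =>
    rw [pow_zero] at hP
    obtain ⟨z, rfl⟩ := Submodule.mem_one.1 hP
    rw [← Algebra.smul_def, map_smul, hT1 γ hγ, smul_zero]
  | succ e =>
    rw [pow_succ'] at hP
    induction hP using Submodule.mul_induction_on' with
    | add P _ P' _ h h' => rw [add_mul, map_add, h, h', add_zero]
    | mem_mul_mem v hv P hP =>
      obtain ⟨b, rfl⟩ := hv
      -- `b = a - γ a` is solvable because `1 - γ` is invertible
      obtain ⟨a, rfl⟩ : ∃ a, a - (γ : SL(2, ℂ)).1.mulVec a = b := by
        refine ⟨(1 - (γ : SL(2, ℂ)).1)⁻¹.mulVec b, ?_⟩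
        have hu : IsUnit (1 - (γ : SL(2, ℂ)).1).det := (hG γ hγ).isUnit
        have h := congrArg (fun N => Matrix.mulVec N b) (Matrix.mul_nonsing_inv _ hu)
        simpa [← Matrix.mulVec_mulVec, Matrix.sub_mulVec] using h
      set a' := (γ : SL(2, ℂ)).1.mulVec a
      have h1 : T (ρ.vec a * P * ρ.grp γ) = T (P * ρ.vec a' * ρ.grp γ) := by
        rw [mul_assoc, hT, mul_assoc, ρ.grp_mul_vec, mul_assoc]
      have h2 : T ((ρ.vec a' * P - P * ρ.vec a') * ρ.grp γ) = 0 := by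
        refine hlow _ (ρ.low_mono e.le_succ (ρ.low_mul_grps e ?_))
        exact Submodule.mul_mem_mul (ρ.comm_mem_low (ρ.vec_mem a') hP) (ρ.grp_mem γ)
      rw [sub_mul, map_sub, sub_eq_zero] at h2
      rw [map_sub, sub_mul, sub_mul, map_sub, h1, h2, sub_self]

/-- A trace that vanishes on the nontrivial group elements vanishes on all products of `d` vectors
and one group element. What remains after `trace_pow_mul_nontrivGrps_eq_zero` is a product `P` of
vectors alone. Expanding `T [x, y P] = T [y, x P]` and using `euler` gives `(d + 2) c₁ T P = 0`. -/
theorem trace_layer_eq_zero (hT : ∀ a b, T (a * b) = T (b * a))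
    (hG : ∀ γ : G, γ ≠ 1 → (1 - (γ : SL(2, ℂ)).1).det ≠ 0) (hc : c.coeff 1 ≠ 0)
    (hT1 : ∀ γ : G, γ ≠ 1 → T (ρ.grp γ) = 0) (d : ℕ) : ∀ a ∈ ρ.layer d, T a = 0 := by
  induction d using Nat.strong_induction_on with
  | _ d ih =>
  have hlow : ∀ a ∈ ρ.low d, T a = 0 := by
    have h : ρ.low d ≤ LinearMap.ker T := iSup₂_le fun i hi => fun a ha => ih i hi a ha
    exact fun a ha => h ha
  have h' := ρ.trace_pow_mul_nontrivGrps_eq_zero T hT hG hT1 hlow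
  have hone : ∀ P ∈ ρ.vecs ^ d, T P = 0 := by
    intro P hP
    have h1 : T (ρ.y * (ρ.x * P - P * ρ.x) - ρ.x * (ρ.y * P - P * ρ.y)) =
        (d * c.coeff 1 : ℂ) * T P := by
      have h : ρ.vecs ^ d * ρ.nontrivGrps ⊔ ρ.low d ≤ LinearMap.ker T :=
        sup_le (fun a ha => h' a ha) (fun a ha => hlow a ha)
      have h := LinearMap.mem_ker.1 (h (ρ.euler hP))
      rwa [map_sub, sub_eq_zero, map_smul, smul_eq_mul] at h
    have h2 : T (ρ.rel * P) = c.coeff 1 * T P := by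
      have h := h' _ (ρ.span_grp_mul_pow _ d (Submodule.mul_mem_mul ρ.rel_sub_mem hP))
      rwa [sub_mul, map_sub, sub_eq_zero, smul_mul_assoc, one_mul, map_smul, smul_eq_mul] at h
    have h3 : ρ.x * ρ.y - ρ.y * ρ.x = ρ.rel := by
      exact (ρ.x_comm ![0, 1]).trans (by simp)
    -- `[x, y P] - [y, x P] = 2 c P + (y [x, P] - x [y, P])`
    have h4 : (ρ.x * (ρ.y * P) - ρ.y * P * ρ.x) - (ρ.y * (ρ.x * P) - ρ.x * P * ρ.y) =
        ρ.rel * P + ρ.rel * P + (ρ.y * (ρ.x * P - P * ρ.x) - ρ.x * (ρ.y * P - P * ρ.y)) := by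
      rw [← h3]
      noncomm_ring
    have h5 := congrArg T h4
    rw [map_sub, map_sub, map_sub, hT ρ.x, hT ρ.y, sub_self, sub_self, sub_self, map_add, map_add,
      h1, h2] at h5
    have h6 : ((d + 2 : ℕ) : ℂ) * (c.coeff 1 * T P) = 0 := by
      push_cast
      linear_combination -h5
    have h7 : ((d + 2 : ℕ) : ℂ) ≠ 0 := Nat.cast_ne_zero.2 (by omega)
    exact (mul_eq_zero.1 ((mul_eq_zero.1 h6).resolve_left h7)).resolve_left hc
  have hle : ρ.grps ≤ 1 ⊔ ρ.nontrivGrps := by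
    rw [grps, Submodule.span_le]
    rintro _ ⟨γ, rfl⟩
    by_cases hγ : γ = 1
    · rw [hγ, map_one]
      exact Submodule.mem_sup_left (Submodule.mem_one.2 ⟨1, map_one _⟩)
    · exact Submodule.mem_sup_right (Submodule.subset_span ⟨γ, hγ, rfl⟩)
  have hle' : ρ.layer d ≤ LinearMap.ker T := by
    refine (mul_le_mul_right hle (ρ.vecs ^ d)).trans ?_
    rw [Submodule.mul_sup, mul_one]
    exact sup_le (fun a ha => hone a ha) (fun a ha => h' a ha)
  exact fun a ha => hle' ha

end Realization

end Vanishing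

/-! ### The algebra `H_c` and its universal property -/

section Universal

variable {G : Subgroup SL(2, ℂ)} {c : MonoidAlgebra ℂ G} {A : Type*} [Ring A] [Algebra ℂ A]

/-- The linear form with given coefficients, as an element of `ℂ⟨x, y⟩`. -/
def linForm : (Fin 2 → ℂ) →ₗ[ℂ] FreeXY := Fintype.linearCombination ℂ (FreeAlgebra.ι ℂ)

theorem linForm_apply (a : Fin 2 → ℂ) : linForm a = a 0 • X + a 1 • Y := by
  simp [linForm, Fintype.linearCombination_apply, X, Y]

theorem subst_linForm (M : Matrix (Fin 2) (Fin 2) ℂ) (a : Fin 2 → ℂ) :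
    subst M (linForm a) = linForm (M.mulVec a) := by
  simp only [linForm_apply, map_add, map_smul, X, Y, subst_ι, Fin.sum_univ_two, Matrix.mulVec,
    dotProduct, add_smul, smul_add, smul_smul]
  rw [mul_comm (a 0), mul_comm (a 0), mul_comm (a 1), mul_comm (a 1)]
  abel

variable (G c) in
/-- The quotient map from the skew group algebra onto `H_c`. -/
def quotMap : Skew G →ₐ[ℂ] H G c := RingQuot.mkAlgHom ℂ (Rel G c)

variable (G c) in
/-- The generators of `H_c` itself. -/
def universal : Realization G c (H G c) where
  vec := (quotMap G c).toLinearMap ∘ₗ SkewMonoidAlgebra.lsingle ℂ (1 : G) ∘ₗ linForm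
  grp := (quotMap G c : Skew G →* H G c).comp (SkewMonoidAlgebra.of FreeXY G)
  grp_mul_vec γ a := by
    change quotMap G c (SkewMonoidAlgebra.single γ 1) *
        quotMap G c (SkewMonoidAlgebra.single 1 (linForm a)) =
      quotMap G c (SkewMonoidAlgebra.single 1 (linForm _)) *
        quotMap G c (SkewMonoidAlgebra.single γ 1)
    rw [← map_mul, ← map_mul, SkewMonoidAlgebra.single_mul_single,
      SkewMonoidAlgebra.single_mul_single, one_smul, one_mul, mul_one, one_mul, mul_one,
      ← subst_linForm]
    rfl
  comm a b := by
    have hrel : quotMap G c (SkewMonoidAlgebra.single 1 (X * Y - Y * X)) =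
        quotMap G c (groupIncl G c) :=
      RingQuot.mkAlgHom_rel ℂ Rel.comm
    have hlift : quotMap G c (groupIncl G c) = MonoidAlgebra.lift ℂ (H G c) G
        ((quotMap G c : Skew G →* H G c).comp (SkewMonoidAlgebra.of FreeXY G)) c := by
      simp only [groupIncl, MonoidAlgebra.lift_apply, Finsupp.sum, map_sum, map_smul]
      rfl
    rw [← hlift, ← hrel, ← map_smul, SkewMonoidAlgebra.smul_single]
    change quotMap G c (SkewMonoidAlgebra.single 1 (linForm a)) *
      quotMap G c (SkewMonoidAlgebra.single 1 (linForm b)) - quotMap G c (SkewMonoidAlgebra.single 1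
        (linForm b)) * quotMap G c (SkewMonoidAlgebra.single 1 (linForm a)) = _
    rw [← map_mul, ← map_mul, SkewMonoidAlgebra.single_mul_single,
      SkewMonoidAlgebra.single_mul_single, one_smul, one_smul, one_mul]
    refine (sub_eq_iff_eq_add (G := H G c)).2 ?_
    rw [← map_add, ← SkewMonoidAlgebra.single_add, linForm_apply, linForm_apply]
    congr 2
    simp only [mul_add, add_mul, smul_mul_smul_comm, sub_smul, smul_sub]
    rw [mul_comm (b 0), mul_comm (b 1), mul_comm (b 0), mul_comm (b 1)]
    abel

/-- `H_c` is spanned by the products of vectors and one group element. -/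
theorem mem_iSup_layer (a : H G c) : a ∈ ⨆ d, (universal G c).layer d := by
  set ρ := universal G c
  have hfree : ∀ P : FreeXY, quotMap G c (SkewMonoidAlgebra.single 1 P) ∈ ⨆ d, ρ.vecs ^ d := by
    intro P
    induction P using FreeAlgebra.induction with
    | grade0 z =>
      refine Submodule.mem_iSup_of_mem 0 ?_
      rw [pow_zero]
      refine Submodule.mem_one.2 ⟨z, ?_⟩
      exact ((quotMap G c).commutes z).symm
    | grade1 i =>
      refine Submodule.mem_iSup_of_mem 1 ?_
      rw [pow_one]
      refine ⟨Pi.single i 1, ?_⟩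
      change quotMap G c (SkewMonoidAlgebra.single 1 (linForm (Pi.single i 1))) = _
      rw [linForm, Fintype.linearCombination_apply_single, one_smul]
    | mul P Q hP hQ =>
      have h := Submodule.mul_mem_mul hP hQ
      simp only [Submodule.iSup_mul, Submodule.mul_iSup, ← pow_add] at h
      have e : (SkewMonoidAlgebra.single 1 (P * Q) : Skew G) =
          SkewMonoidAlgebra.single 1 P * SkewMonoidAlgebra.single 1 Q := by
        rw [SkewMonoidAlgebra.single_mul_single, one_smul, one_mul]
      rw [e, map_mul]
      have hle : (⨆ i, ⨆ j, ρ.vecs ^ (j + i)) ≤ ⨆ d, ρ.vecs ^ d :=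
        iSup₂_le fun i j => le_iSup (fun d => ρ.vecs ^ d) (j + i)
      exact hle h
    | add P Q hP hQ =>
      rw [SkewMonoidAlgebra.single_add, map_add]
      exact add_mem hP hQ
  obtain ⟨a, rfl⟩ : ∃ b, quotMap G c b = a := RingQuot.mkAlgHom_surjective ℂ (Rel G c) a
  induction a using SkewMonoidAlgebra.induction_on with
  | zero => rw [map_zero]; exact zero_mem _
  | add a b ha hb => rw [map_add]; exact add_mem ha hb
  | single γ P =>
    have e : (SkewMonoidAlgebra.single γ P : Skew G) =
        SkewMonoidAlgebra.single 1 P * SkewMonoidAlgebra.single γ 1 := by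
      rw [SkewMonoidAlgebra.single_mul_single, one_smul, one_mul, mul_one]
    rw [e, map_mul]
    have h := Submodule.mul_mem_mul (hfree P) (ρ.grp_mem γ)
    rwa [Submodule.iSup_mul] at h

/-- If no nontrivial element of `G` has the eigenvalue `1`, a trace on `H_c` is determined by its
values on the nontrivial group elements. -/
theorem trace_eq_zero (hG : ∀ γ : G, γ ≠ 1 → (1 - (γ : SL(2, ℂ)).1).det ≠ 0) (hc : c.coeff 1 ≠ 0)
    {T : H G c →ₗ[ℂ] ℂ} (hT : T ∈ traces (H G c))
    (hT1 : ∀ γ : G, γ ≠ 1 → T ((universal G c).grp γ) = 0) : T = 0 := by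
  ext a
  have h : (⨆ d, (universal G c).layer d) ≤ LinearMap.ker T :=
    iSup_le fun d a ha => (universal G c).trace_layer_eq_zero T hT hG hc hT1 d a ha
  exact h (mem_iSup_layer a)

namespace Realization

variable (ρ : Realization G c A)

/-- The homomorphism from the free algebra given by the vectors of a realization. -/
def freeLift : FreeXY →ₐ[ℂ] A := FreeAlgebra.lift ℂ fun i => ρ.vec (Pi.single i 1)

theorem freeLift_linForm (a : Fin 2 → ℂ) : ρ.freeLift (linForm a) = ρ.vec a := by
  conv_rhs => rw [pi_eq_sum_univ' a, map_sum]
  simp only [linForm, Fintype.linearCombination_apply, map_sum, map_smul, freeLift,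
    FreeAlgebra.lift_ι_apply]


/-- The homomorphism from the skew group algebra given by a realization. -/
def skewLift : Skew G →ₐ[ℂ] A :=
  SkewMonoidAlgebra.liftNCAlgHom ρ.freeLift ρ.grp (by
    intro P γ
    induction P using FreeAlgebra.induction with
    | grade0 z => 
      rw [smul_algebraMap, AlgHom.commutes, Algebra.commutes]
    | grade1 i =>
      have e : FreeAlgebra.ι ℂ i = linForm (Pi.single i 1) := by
        rw [linForm, Fintype.linearCombination_apply_single, one_smul]
      have e' : γ • linForm (Pi.single i 1) = linForm ((γ : SL(2, ℂ)).1.mulVec (Pi.single i 1)) :=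
        subst_linForm _ _
      rw [e, e', freeLift_linForm, freeLift_linForm, ρ.grp_mul_vec]
    | mul P Q hP hQ => rw [smul_mul', map_mul, mul_assoc, hQ, ← mul_assoc, hP, mul_assoc, map_mul]
    | add P Q hP hQ => rw [smul_add, map_add, add_mul, hP, hQ, map_add, mul_add])

theorem skewLift_single (γ : G) (P : FreeXY) :
    ρ.skewLift (SkewMonoidAlgebra.single γ P) = ρ.freeLift P * ρ.grp γ :=
  SkewMonoidAlgebra.liftNC_single _ _ _ _

theorem skewLift_rel ⦃a b : Skew G⦄ (h : Rel G c a b) : ρ.skewLift a = ρ.skewLift b := by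
  cases h
  have hX : X = linForm ![1, 0] := by simp [linForm_apply]
  have hY : Y = linForm ![0, 1] := by simp [linForm_apply]
  rw [skewLift_single, map_one, mul_one, hX, hY, map_sub, map_mul, map_mul, freeLift_linForm,
    freeLift_linForm, ρ.comm]
  simp only [groupIncl, MonoidAlgebra.lift_apply, Finsupp.sum, map_sum, map_smul]
  simp [skewLift_single]

/-- The homomorphism from `H_c` given by a realization. -/
def lift : H G c →ₐ[ℂ] A := RingQuot.liftAlgHom ℂ ⟨ρ.skewLift, ρ.skewLift_rel⟩

theorem lift_mk (a : Skew G) : ρ.lift (quotMap G c a) = ρ.skewLift a :=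
  RingQuot.liftAlgHom_mkAlgHom_apply _ _ _ _

theorem lift_grp (γ : G) : ρ.lift ((universal G c).grp γ) = ρ.grp γ := by
  refine (ρ.lift_mk _).trans ((ρ.skewLift_single γ 1).trans ?_)
  rw [map_one, one_mul]

theorem lift_vec (a : Fin 2 → ℂ) : ρ.lift ((universal G c).vec a) = ρ.vec a := by
  refine (ρ.lift_mk _).trans ((ρ.skewLift_single 1 (linForm a)).trans ?_)
  rw [map_one, mul_one, freeLift_linForm]

end Realization

end Universal

/-! ### The dicyclic group -/

section Group

/-- The matrix `diag (a, a⁻¹)`. -/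
def diagSL : ℂˣ →* SL(2, ℂ) where
  toFun a := ⟨!![(a : ℂ), 0; 0, ((a⁻¹ : ℂˣ) : ℂ)], by simp [Matrix.det_fin_two_of]⟩
  map_one' := by
    ext i j
    fin_cases i <;> fin_cases j <;> simp
  map_mul' a b := by
    refine Subtype.ext (Eq.trans ?_ (Matrix.SpecialLinearGroup.coe_mul _ _).symm)
    simp [mul_comm]

theorem diagSL_coe (a : ℂˣ) :
    (diagSL a).1 = !![(a : ℂ), 0; 0, ((a⁻¹ : ℂˣ) : ℂ)] := rfl

theorem hMat_coe : hMat.1 = !![0, 1; -1, 0] := rfl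

theorem diagSL_mul_hMat_coe (a : ℂˣ) :
    (diagSL a * hMat).1 = !![0, (a : ℂ); -((a⁻¹ : ℂˣ) : ℂ), 0] := by
  rw [Matrix.SpecialLinearGroup.coe_mul, diagSL_coe, hMat_coe]
  simp

theorem hMat_mul_diagSL (a : ℂˣ) : hMat * diagSL a = diagSL a⁻¹ * hMat := by
  refine Subtype.ext ?_
  rw [diagSL_mul_hMat_coe, Matrix.SpecialLinearGroup.coe_mul, diagSL_coe, hMat_coe]
  simp

theorem hMat_mul_hMat : hMat * hMat = diagSL (-1) := by
  refine Subtype.ext ?_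
  rw [Matrix.SpecialLinearGroup.coe_mul, diagSL_coe, hMat_coe]
  simp

/-- `ε = exp (2 π i / n)` as a unit. -/
def epsUnit (n : ℕ) : ℂˣ := Units.mk0 (eps n) (Complex.exp_ne_zero _)

theorem diagSL_epsUnit (n : ℕ) : diagSL (epsUnit n) = gMat n := by
  refine Subtype.ext ?_
  rw [diagSL_coe, Units.val_inv_eq_inv_val]
  rfl

theorem isPrimitiveRoot_epsUnit {n : ℕ} (hn : n ≠ 0) : IsPrimitiveRoot (epsUnit n) n := by
  rw [← IsPrimitiveRoot.coe_units_iff]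
  exact Complex.isPrimitiveRoot_exp n hn

theorem exists_epsUnit_pow {n : ℕ} (hn : 0 < n) {a : ℂˣ} (ha : a ^ n = 1) :
    ∃ k < n, epsUnit n ^ k = a := by
  have : NeZero n := ⟨hn.ne'⟩
  have h : (a : ℂ) ^ n = 1 := by rw [← Units.val_pow_eq_pow_val, ha, Units.val_one]
  obtain ⟨k, hk, h⟩ := (Complex.isPrimitiveRoot_exp n hn.ne').eq_pow_of_pow_eq_one h
  exact ⟨k, hk, Units.ext ((Units.val_pow_eq_pow_val _ _).trans h)⟩

/-- The elements of the dicyclic group are `diag (a, a⁻¹)` and `diag (a, a⁻¹) h` with `a ^ n = 1`.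
As `h² = diag (-1, -1)`, this needs `n` to be even. -/
theorem mem_dicyclic_iff {n : ℕ} (hn : 0 < n) (hn_even : Even n) {γ : SL(2, ℂ)} :
    γ ∈ dicyclic n ↔ ∃ a : ℂˣ, a ^ n = 1 ∧ (γ = diagSL a ∨ γ = diagSL a * hMat) := by
  constructor
  · intro h
    induction h using Subgroup.closure_induction with
    | mem γ hγ =>
      rcases hγ with rfl | rfl
      · exact ⟨epsUnit n, (isPrimitiveRoot_epsUnit hn.ne').pow_eq_one,
          Or.inl (diagSL_epsUnit n).symm⟩
      · exact ⟨1, one_pow _, Or.inr (by simp)⟩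
    | one => exact ⟨1, one_pow _, Or.inl (by simp)⟩
    | mul γ δ _ _ hγ hδ =>
      obtain ⟨a, ha, rfl | rfl⟩ := hγ <;> obtain ⟨b, hb, rfl | rfl⟩ := hδ
      · exact ⟨a * b, by rw [mul_pow, ha, hb, one_mul], Or.inl (map_mul _ _ _).symm⟩
      · exact ⟨a * b, by rw [mul_pow, ha, hb, one_mul], Or.inr (by rw [map_mul, mul_assoc])⟩
      · exact ⟨a * b⁻¹, by rw [mul_pow, ha, inv_pow, hb, inv_one, one_mul],
          Or.inr (by rw [mul_assoc, hMat_mul_diagSL, map_mul, mul_assoc])⟩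
      · refine ⟨a * b⁻¹ * (-1), by rw [mul_pow, mul_pow, ha, inv_pow, hb, hn_even.neg_one_pow,
          inv_one, one_mul, one_mul], Or.inl ?_⟩
        rw [mul_assoc, ← mul_assoc hMat, hMat_mul_diagSL, mul_assoc, hMat_mul_hMat, map_mul,
          map_mul, mul_assoc]
    | inv γ _ hγ =>
      obtain ⟨a, ha, rfl | rfl⟩ := hγ
      · exact ⟨a⁻¹, by rw [inv_pow, ha, inv_one], Or.inl (map_inv _ _).symm⟩
      · refine ⟨-a, by rw [hn_even.neg_pow, ha], Or.inr ?_⟩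
        rw [inv_eq_iff_mul_eq_one, mul_assoc, ← mul_assoc hMat, hMat_mul_diagSL, mul_assoc,
          hMat_mul_hMat, ← map_mul, ← map_mul]
        simp
  · rintro ⟨a, ha, h⟩
    obtain ⟨k, _, rfl⟩ := exists_epsUnit_pow hn ha
    have hg : diagSL (epsUnit n ^ k) ∈ dicyclic n := by
      rw [map_pow, diagSL_epsUnit]
      exact pow_mem (Subgroup.subset_closure (by simp)) k
    rcases h with rfl | rfl
    · exact hg
    · exact mul_mem hg (Subgroup.subset_closure (by simp))

theorem det_one_sub_ne_zero {n : ℕ} (hn : 0 < n) (hn_even : Even n) (γ : dicyclic n) (hγ : γ ≠ 1) :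
    (1 - (γ : SL(2, ℂ)).1).det ≠ 0 := by
  obtain ⟨γ, hmem⟩ := γ
  obtain ⟨a, -, rfl | rfl⟩ := (mem_dicyclic_iff hn hn_even).1 hmem
  · have ha : (a : ℂ) ≠ 1 := by
      rintro h
      refine hγ (Subtype.ext ?_)
      exact (congrArg diagSL (Units.val_eq_one.1 h)).trans (map_one _)
    have ha0 := a.ne_zero
    simp only [diagSL_coe, Matrix.det_fin_two, Matrix.sub_apply, Matrix.one_apply]
    simp only [Matrix.of_apply, Matrix.cons_val', Matrix.cons_val_zero, Matrix.cons_val_fin_one,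
      Matrix.cons_val_one, Units.val_inv_eq_inv_val]
    have : (1 - (a : ℂ)) * (1 - (a : ℂ)⁻¹) = -(1 - (a : ℂ)) ^ 2 * (a : ℂ)⁻¹ := by field_simp; ring
    simp only [if_true, zero_ne_one, one_ne_zero, if_false, sub_self, mul_zero, sub_zero, this]
    exact mul_ne_zero (neg_ne_zero.2 (pow_ne_zero 2 (sub_ne_zero.2 ha.symm))) (inv_ne_zero ha0)
  · simp only [diagSL_mul_hMat_coe, Matrix.det_fin_two, Matrix.sub_apply, Matrix.one_apply]
    simp

end Group

/-! ### The eigenvalues of `c` on characters of the cyclic subgroup -/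

section Weight

/-- The upper left entry of a matrix as a unit, with the value `1` if this entry vanishes. -/
def entryUnit (γ : SL(2, ℂ)) : ℂˣ := if h : γ.1 0 0 ≠ 0 then Units.mk0 _ h else 1

theorem entryUnit_diagSL (a : ℂˣ) : entryUnit (diagSL a) = a := by
  have h : (diagSL a).1 0 0 ≠ 0 := a.ne_zero
  rw [entryUnit, dif_pos h]
  exact Units.ext rfl

variable {n : ℕ} {c : MonoidAlgebra ℂ (dicyclic n)}

variable (c) in
/-- The scalar by which `c ∈ ℂ[C_n]` acts where `diag (a, a⁻¹)` acts as `a ^ m`. Meaningful only for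
`c` supported on the cyclic subgroup. -/
def weight (m : ℤ) : ℂ :=
  c.coeff.sum fun γ z => z * ((entryUnit (γ : SL(2, ℂ)) ^ m : ℂˣ) : ℂ)

theorem exists_eq_diagSL_of_mem_zpowers (hn : 0 < n) {γ : SL(2, ℂ)}
    (h : γ ∈ Subgroup.zpowers (gMat n)) :
    ∃ a : ℂˣ, a ^ n = 1 ∧ γ = diagSL a := by
  obtain ⟨k, rfl⟩ := Subgroup.mem_zpowers_iff.1 h
  refine ⟨epsUnit n ^ k, ?_, by rw [map_zpow, diagSL_epsUnit]⟩
  rw [← zpow_natCast, ← zpow_mul, mul_comm, zpow_mul, zpow_natCast,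
    (isPrimitiveRoot_epsUnit hn.ne').pow_eq_one, one_zpow]

theorem weight_add_period (hn : 0 < n) (hc : ∀ γ : dicyclic n, c.coeff γ ≠ 0 →
    (γ : SL(2, ℂ)) ∈ Subgroup.zpowers (gMat n)) (m : ℤ) : weight c (m + n) = weight c m := by
  refine Finset.sum_congr rfl fun γ hγ => ?_
  obtain ⟨a, ha, h⟩ := exists_eq_diagSL_of_mem_zpowers hn (hc γ (Finsupp.mem_support_iff.1 hγ))
  simp only [h, entryUnit_diagSL]
  rw [zpow_add, zpow_natCast, ha, mul_one]

/-- By orthogonality of characters only the coefficient of `c` at the identity survives. -/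
theorem sum_weight (hn : 0 < n) (hc : ∀ γ : dicyclic n, c.coeff γ ≠ 0 →
    (γ : SL(2, ℂ)) ∈ Subgroup.zpowers (gMat n)) :
    ∑ i ∈ Finset.range n, weight c i = n * c.coeff 1 := by
  simp only [weight, Finsupp.sum]
  rw [Finset.sum_comm]
  have h : ∀ γ ∈ c.coeff.support, γ ≠ 1 → ∑ i ∈ Finset.range n,
      c.coeff γ * ((entryUnit (γ : SL(2, ℂ)) ^ (i : ℤ) : ℂˣ) : ℂ) = 0 := by
    intro γ hγ h1
    obtain ⟨a, ha, h⟩ := exists_eq_diagSL_of_mem_zpowers hn (hc γ (Finsupp.mem_support_iff.1 hγ))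
    have ha1 : (a : ℂ) ≠ 1 := by
      rintro h'
      refine h1 (Subtype.ext (h.trans ?_))
      exact (congrArg diagSL (Units.val_eq_one.1 h')).trans (map_one _)
    rw [← Finset.mul_sum]
    simp only [h, entryUnit_diagSL, zpow_natCast, Units.val_pow_eq_pow_val]
    rw [geom_sum_eq ha1, ← Units.val_pow_eq_pow_val, ha]
    simp
  rw [Finset.sum_eq_single 1 h]
  · have h1 : entryUnit 1 = 1 := by
      have := entryUnit_diagSL 1
      rwa [map_one] at this
    simp [h1]
  · intro h
    rw [Finsupp.notMem_support_iff] at h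
    simp [h]

/-- `h` as an element of the dicyclic group. -/
def hElt (n : ℕ) : dicyclic n := ⟨hMat, Subgroup.subset_closure (by simp)⟩

/-- `g` as an element of the dicyclic group. -/
def gElt (n : ℕ) : dicyclic n := ⟨gMat n, Subgroup.subset_closure (by simp)⟩

theorem coeff_conj (hc : c ∈ Subalgebra.center ℂ (MonoidAlgebra ℂ (dicyclic n)))
    (γ δ : dicyclic n) : c.coeff (δ * γ * δ⁻¹) = c.coeff γ := by
  have h := (Subalgebra.mem_center_iff.1 hc) (MonoidAlgebra.single δ 1)
  have h := congrArg (fun u => u.coeff (δ * γ)) h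
  simpa using h.symm

theorem weight_neg (hn : 0 < n)
    (hcent : c ∈ Subalgebra.center ℂ (MonoidAlgebra ℂ (dicyclic n)))
    (hc : ∀ γ : dicyclic n, c.coeff γ ≠ 0 →
    (γ : SL(2, ℂ)) ∈ Subgroup.zpowers (gMat n)) (m : ℤ) : weight c (-m) = weight c m := by
  simp only [weight, Finsupp.sum]
  refine Finset.sum_bij' (fun γ _ => hElt n * γ * (hElt n)⁻¹) (fun γ _ => (hElt n)⁻¹ * γ * hElt n)
    ?_ ?_ ?_ ?_ ?_
  · intro γ hγ
    rw [Finsupp.mem_support_iff] at hγ ⊢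
    rwa [coeff_conj hcent]
  · intro γ hγ
    rw [Finsupp.mem_support_iff] at hγ ⊢
    have := coeff_conj hcent γ (hElt n)⁻¹
    rw [inv_inv] at this
    rwa [this]
  · intro γ _
    group
  · intro γ _
    group
  · intro γ hγ
    obtain ⟨a, ha, h⟩ := exists_eq_diagSL_of_mem_zpowers hn (hc γ (Finsupp.mem_support_iff.1 hγ))
    have h' : ((hElt n * γ * (hElt n)⁻¹ : dicyclic n) : SL(2, ℂ)) = diagSL a⁻¹ := by
      change hMat * (γ : SL(2, ℂ)) * hMat⁻¹ = _
      rw [h, hMat_mul_diagSL, mul_inv_cancel_right]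
    rw [coeff_conj hcent, h', h, entryUnit_diagSL, entryUnit_diagSL, inv_zpow, zpow_neg]

end Weight

/-! ### Traces on `H_c` from representations -/

/-- Elements of `A` that satisfy the relations between `x`, `y`, `h` and the diagonal torus of
`SL(2, ℂ)`. Together with `x y - y x = c` they give a realization of the relations of `H_c`. -/
structure TorusData (A : Type*) [Ring A] [Algebra ℂ A] where
  X : A
  Y : A
  h : A
  D : ℂˣ →* A
  D_mul_X : ∀ a, D a * X = (a : ℂ) • (X * D a)
  D_mul_Y : ∀ a, D a * Y = ((a⁻¹ : ℂˣ) : ℂ) • (Y * D a)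
  h_mul_D : ∀ a, h * D a = D a⁻¹ * h
  h_mul_h : h * h = D (-1)
  h_mul_X : h * X = -(Y * h)
  h_mul_Y : h * Y = X * h

namespace TorusData

variable {n : ℕ} {A : Type*} [Ring A] [Algebra ℂ A] (S : TorusData A)

open Classical in
/-- The action of `diag (a, a⁻¹)` and `diag (a, a⁻¹) h`, junk on all other matrices. -/
def grpFun (γ : SL(2, ℂ)) : A :=
  if γ.1 0 0 ≠ 0 then S.D (entryUnit γ) else S.D (entryUnit (γ * hMat⁻¹)) * S.h

theorem grpFun_diagSL (a : ℂˣ) : S.grpFun (diagSL a) = S.D a := by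
  rw [grpFun, if_pos (show (diagSL a).1 0 0 ≠ 0 from a.ne_zero), entryUnit_diagSL]

theorem grpFun_diagSL_mul_hMat (a : ℂˣ) : S.grpFun (diagSL a * hMat) = S.D a * S.h := by
  rw [grpFun, if_neg, mul_inv_cancel_right, entryUnit_diagSL]
  rw [diagSL_mul_hMat_coe]
  simp

/-- The action of the dicyclic group. -/
def grpHom (hn : 0 < n) (hn_even : Even n) : dicyclic n →* A where
  toFun γ := S.grpFun γ
  map_one' := by
    have := S.grpFun_diagSL 1
    rwa [map_one, map_one] at this
  map_mul' γ δ := by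
    obtain ⟨γ, hγ⟩ := γ
    obtain ⟨δ, hδ⟩ := δ
    change S.grpFun (γ * δ) = S.grpFun γ * S.grpFun δ
    obtain ⟨a, ha, rfl | rfl⟩ := (mem_dicyclic_iff hn hn_even).1 hγ <;>
      obtain ⟨b, hb, rfl | rfl⟩ := (mem_dicyclic_iff hn hn_even).1 hδ
    · rw [← map_mul, grpFun_diagSL, grpFun_diagSL, grpFun_diagSL, map_mul]
    · rw [← mul_assoc, ← map_mul, grpFun_diagSL, grpFun_diagSL_mul_hMat, grpFun_diagSL_mul_hMat,
        map_mul, mul_assoc]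
    · rw [mul_assoc, hMat_mul_diagSL, ← mul_assoc, ← map_mul, grpFun_diagSL, grpFun_diagSL_mul_hMat,
        grpFun_diagSL_mul_hMat, mul_assoc, S.h_mul_D b, map_mul, mul_assoc]
    · rw [mul_assoc, ← mul_assoc hMat, hMat_mul_diagSL, mul_assoc, hMat_mul_hMat, ← map_mul,
        ← map_mul, grpFun_diagSL, grpFun_diagSL_mul_hMat, grpFun_diagSL_mul_hMat, mul_assoc,
        ← mul_assoc S.h, S.h_mul_D b, mul_assoc, S.h_mul_h, map_mul, map_mul]

theorem grpHom_apply (hn : 0 < n) (hn_even : Even n) (γ : dicyclic n) :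
    S.grpHom hn hn_even γ = S.grpFun γ := rfl

/-- The realization of the relations of `H_c` given by torus data with `x y - y x = c`. -/
def toRealization (hn : 0 < n) (hn_even : Even n) {c : MonoidAlgebra ℂ (dicyclic n)}
    (hc : ∀ γ : dicyclic n, c.coeff γ ≠ 0 → (γ : SL(2, ℂ)) ∈ Subgroup.zpowers (gMat n))
    (hcomm : S.X * S.Y - S.Y * S.X = c.coeff.sum fun γ z => z • S.D (entryUnit (γ : SL(2, ℂ)))) :
    Realization (dicyclic n) c A where
  vec := Fintype.linearCombination ℂ ![S.X, S.Y]
  grp := S.grpHom hn hn_even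
  grp_mul_vec γ v := by
    obtain ⟨γ, hγ⟩ := γ
    rw [grpHom_apply]
    simp only [Fintype.linearCombination_apply, Fin.sum_univ_two, Matrix.cons_val_zero,
      Matrix.cons_val_one, Matrix.mulVec, dotProduct]
    obtain ⟨a, ha, rfl | rfl⟩ := (mem_dicyclic_iff hn hn_even).1 hγ
    · simp only [grpFun_diagSL, diagSL_coe, Matrix.of_apply, Matrix.cons_val', Matrix.cons_val_zero,
        Matrix.cons_val_one, Matrix.cons_val_fin_one, zero_mul, zero_add, add_zero, mul_add,
        mul_smul_comm, add_mul, smul_mul_assoc, S.D_mul_X a, S.D_mul_Y a, smul_smul]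
      rw [mul_comm (v 0), mul_comm (v 1)]
    · simp only [grpFun_diagSL_mul_hMat, diagSL_mul_hMat_coe, Matrix.of_apply, Matrix.cons_val',
        Matrix.cons_val_zero,
        Matrix.cons_val_one, Matrix.cons_val_fin_one, zero_mul, zero_add, add_zero, mul_add,
        mul_smul_comm, add_mul, smul_mul_assoc, mul_assoc, S.h_mul_X, S.h_mul_Y]
      rw [← mul_assoc _ S.X, mul_neg, ← mul_assoc _ S.Y, S.D_mul_X a, S.D_mul_Y a, add_comm]
      simp only [smul_mul_assoc, smul_neg, smul_smul, neg_mul, neg_smul, mul_assoc]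
      rw [mul_comm (v 0), mul_comm (v 1)]
  comm v w := by
    have hrel : S.X * S.Y - S.Y * S.X = MonoidAlgebra.lift ℂ A (dicyclic n)
        (S.grpHom hn hn_even) c := by
      rw [hcomm, MonoidAlgebra.lift_apply]
      refine Finset.sum_congr rfl fun γ hγ => ?_
      obtain ⟨a, ha, h⟩ := exists_eq_diagSL_of_mem_zpowers hn (hc γ (Finsupp.mem_support_iff.1 hγ))
      simp only [h, entryUnit_diagSL, grpHom_apply, grpFun_diagSL]
    rw [← hrel]
    simp only [Fintype.linearCombination_apply, Fin.sum_univ_two, Matrix.cons_val_zero,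
      Matrix.cons_val_one, mul_add, add_mul, smul_mul_smul_comm, sub_smul, smul_sub]
    rw [mul_comm (w 0), mul_comm (w 1), mul_comm (w 0), mul_comm (w 1)]
    abel

/-- A subalgebra of `H_c` that contains the vectors, the cyclic subgroup and `h` is everything. -/
theorem eq_top_of_generators (hn : 0 < n) (hn_even : Even n) {c : MonoidAlgebra ℂ (dicyclic n)}
    (B : Subalgebra ℂ (H (dicyclic n) c)) (hvec : ∀ v, (universal (dicyclic n) c).vec v ∈ B)
    (hdiag : ∀ γ : dicyclic n, ∀ a : ℂˣ, a ^ n = 1 → (γ : SL(2, ℂ)) = diagSL a →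
      (universal (dicyclic n) c).grp γ ∈ B)
    (hh : (universal (dicyclic n) c).grp (hElt n) ∈ B) (b : H (dicyclic n) c) : b ∈ B := by
  set ρ := universal (dicyclic n) c
  have hgrp : ∀ γ, ρ.grp γ ∈ B := by
    intro γ
    obtain ⟨a, ha, h | h⟩ := (mem_dicyclic_iff hn hn_even).1 γ.2
    · exact hdiag γ a ha h
    · have e : γ = ⟨diagSL a, (mem_dicyclic_iff hn hn_even).2 ⟨a, ha, Or.inl rfl⟩⟩ * hElt n :=
        Subtype.ext h
      rw [e, map_mul]
      exact mul_mem (hdiag _ a ha rfl) hh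
  have h : (⨆ d, ρ.layer d) ≤ B.toSubmodule := by
    refine iSup_le fun d => ?_
    rw [Realization.layer, Submodule.mul_le]
    intro P hP m hm
    refine mul_mem (S := Subalgebra ℂ (H (dicyclic n) c)) (s := B) ?_ ?_
    · refine ρ.pow_induction (Q := fun _ P => P ∈ B) (one_mem _) ?_ ?_ ?_ hP
      · rintro d _ P ⟨a, rfl⟩ - hP
        exact mul_mem (hvec a) hP
      · exact fun _ _ _ h h' => add_mem h h'
      · exact fun _ z _ h => B.smul_mem h z
    · have hle : ρ.grps ≤ B.toSubmodule := by
        rw [Realization.grps, Submodule.span_le]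
        rintro _ ⟨γ, rfl⟩
        exact hgrp γ
      exact hle hm
  exact h (mem_iSup_layer b)

/-- A functional on the image of `H_c` in `A` that is cyclic with respect to the generators gives
a trace on `H_c`. The image is controlled by a subspace that is stable under left
multiplication by the generators. -/
theorem exists_trace (hn : 0 < n) (hn_even : Even n) {c : MonoidAlgebra ℂ (dicyclic n)}
    (hc : ∀ γ : dicyclic n, c.coeff γ ≠ 0 → (γ : SL(2, ℂ)) ∈ Subgroup.zpowers (gMat n))
    (hcomm : S.X * S.Y - S.Y * S.X = c.coeff.sum fun γ z => z • S.D (entryUnit (γ : SL(2, ℂ))))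
    (W : Submodule ℂ A) (hone : 1 ∈ W) (hX : ∀ w ∈ W, S.X * w ∈ W) (hY : ∀ w ∈ W, S.Y * w ∈ W)
    (hD : ∀ a, a ^ n = 1 → ∀ w ∈ W, S.D a * w ∈ W) (hh : ∀ w ∈ W, S.h * w ∈ W)
    (F : A → ℂ) (hFadd : ∀ w ∈ W, ∀ w' ∈ W, F (w + w') = F w + F w')
    (hFsmul : ∀ z : ℂ, ∀ w ∈ W, F (z • w) = z * F w)
    (hFX : ∀ w ∈ W, F (S.X * w) = F (w * S.X)) (hFY : ∀ w ∈ W, F (S.Y * w) = F (w * S.Y))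
    (hFD : ∀ a, a ^ n = 1 → ∀ w ∈ W, F (S.D a * w) = F (w * S.D a))
    (hFh : ∀ w ∈ W, F (S.h * w) = F (w * S.h)) :
    ∃ T ∈ traces (H (dicyclic n) c), ∀ γ : dicyclic n,
      T ((universal (dicyclic n) c).grp γ) = F (S.grpFun γ) := by
  set ρ := S.toRealization hn hn_even hc hcomm with hρ
  have hvec : ∀ v, ρ.lift ((universal (dicyclic n) c).vec v) = v 0 • S.X + v 1 • S.Y := by
    intro v
    rw [ρ.lift_vec]
    simp [hρ, toRealization, Fintype.linearCombination_apply]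
  have hgrp : ∀ γ, ρ.lift ((universal (dicyclic n) c).grp γ) = S.grpFun γ := fun γ => ρ.lift_grp γ
  have hdiag : ∀ (γ : dicyclic n) (a : ℂˣ), (γ : SL(2, ℂ)) = diagSL a →
      ρ.lift ((universal (dicyclic n) c).grp γ) = S.D a := by
    intro γ a h
    rw [hgrp, h, grpFun_diagSL]
  have hhElt : ρ.lift ((universal (dicyclic n) c).grp (hElt n)) = S.h := by
    have h := S.grpFun_diagSL_mul_hMat 1
    rw [map_one, map_one, one_mul, one_mul] at h
    rw [hgrp, ← h]
    rfl
  have hW : ∀ b : H (dicyclic n) c, ρ.lift b ∈ W := by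
    let B : Subalgebra ℂ (H (dicyclic n) c) :=
      { carrier := {b | ∀ w ∈ W, ρ.lift b * w ∈ W}
        mul_mem' := fun {b b'} hb hb' w hw => by
          rw [map_mul, mul_assoc]
          exact hb _ (hb' _ hw)
        add_mem' := fun {b b'} hb hb' w hw => by
          rw [map_add, add_mul]
          exact add_mem (hb w hw) (hb' w hw)
        algebraMap_mem' := fun z w hw => by
          rw [AlgHom.commutes, ← Algebra.smul_def]
          exact W.smul_mem z hw }
    intro b
    have h : b ∈ B := by
      refine eq_top_of_generators hn hn_even B ?_ ?_ ?_ b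
      · intro v w hw
        rw [hvec, add_mul, smul_mul_assoc, smul_mul_assoc]
        exact add_mem (W.smul_mem _ (hX w hw)) (W.smul_mem _ (hY w hw))
      · intro γ a ha h w hw
        rw [hdiag γ a h]
        exact hD a ha w hw
      · intro w hw
        rw [hhElt]
        exact hh w hw
    have := h 1 hone
    rwa [mul_one] at this
  let T : H (dicyclic n) c →ₗ[ℂ] ℂ :=
    { toFun := fun b => F (ρ.lift b)
      map_add' := fun b b' => by rw [map_add, hFadd _ (hW b) _ (hW b')]
      map_smul' := fun z b => by rw [map_smul, hFsmul z _ (hW b)]; rfl }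
  have hTapp : ∀ b, T b = F (ρ.lift b) := fun b => rfl
  refine ⟨T, ?_, fun γ => congrArg F (hgrp γ)⟩
  let B : Subalgebra ℂ (H (dicyclic n) c) :=
    { carrier := {b | ∀ b', T (b * b') = T (b' * b)}
      mul_mem' := fun {b₁ b₂} h₁ h₂ b' => by rw [mul_assoc, h₁, mul_assoc, h₂, mul_assoc]
      add_mem' := fun {b₁ b₂} h₁ h₂ b' => by rw [add_mul, mul_add, map_add, map_add, h₁, h₂]
      algebraMap_mem' := fun z b' => by rw [Algebra.commutes] }
  intro b
  have h : b ∈ B := by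
    refine eq_top_of_generators hn hn_even B ?_ ?_ ?_ b
    · intro v b'
      have hw := hW b'
      have hWX : ρ.lift b' * S.X ∈ W := by
        have h := hW (b' * (universal (dicyclic n) c).vec ![1, 0])
        rw [map_mul, hvec] at h
        simpa using h
      have hWY : ρ.lift b' * S.Y ∈ W := by
        have h := hW (b' * (universal (dicyclic n) c).vec ![0, 1])
        rw [map_mul, hvec] at h
        simpa using h
      rw [hTapp, hTapp, map_mul, map_mul, hvec, add_mul, mul_add, smul_mul_assoc, smul_mul_assoc,
        mul_smul_comm, mul_smul_comm, hFadd _ (W.smul_mem _ (hX _ hw)) _ (W.smul_mem _ (hY _ hw)),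
        hFadd _ (W.smul_mem _ hWX) _ (W.smul_mem _ hWY), hFsmul _ _ (hX _ hw),
        hFsmul _ _ (hY _ hw), hFsmul _ _ hWX, hFsmul _ _ hWY, hFX _ hw, hFY _ hw]
    · intro γ a ha h b'
      rw [hTapp, hTapp, map_mul, map_mul, hdiag γ a h]
      exact hFD a ha _ (hW b')
    · intro b'
      rw [hTapp, hTapp, map_mul, map_mul, hhElt]
      exact hFh _ (hW b')
  exact h

end TorusData

/-! ### Representations induced from weight modules -/

/-!
A weight module of the subalgebra of `H_c` generated by `x`, `y` and `g` is a free module with basis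
`(v_m)`, `m ∈ ℤ`, on which `x v_m = a_m v_{m+1}`, `y v_m = d_m v_{m-1}` and `diag (u, u⁻¹)` acts by
`u ^ (m + j₀)`. The representation of `H_c` that it induces has the basis `v_m`, `h v_m`, indexed by
`false` and `true`. As `h x = -y h` and `h y = x h`, the generators exchange roles on the second
half. -/

section Lattice

variable {R : Type*} [CommRing R] (a d : ℤ → R)

/-- Families of coefficients with respect to the vectors `v_m` (`false`) and `h v_m` (`true`). -/
abbrev Lat (R : Type*) : Type _ := Bool → ℤ → R

/-- The action of `x`. -/
def latX : Module.End R (Lat R) where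
  toFun f b m := bif b then d (m + 1) * f true (m + 1) else a (m - 1) * f false (m - 1)
  map_add' f f' := by ext b m; cases b <;> simp [mul_add]
  map_smul' r f := by ext b m; cases b <;> simp [mul_left_comm]

/-- The action of `y`. -/
def latY : Module.End R (Lat R) where
  toFun f b m := bif b then -(a (m - 1) * f true (m - 1)) else d (m + 1) * f false (m + 1)
  map_add' f f' := by ext b m; cases b <;> simp [mul_add, add_comm]
  map_smul' r f := by ext b m; cases b <;> simp [mul_left_comm]

theorem latX_apply_false (f : Lat R) (m : ℤ) :
    latX a d f false m = a (m - 1) * f false (m - 1) := rfl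

theorem latX_apply_true (f : Lat R) (m : ℤ) :
    latX a d f true m = d (m + 1) * f true (m + 1) := rfl

theorem latY_apply_false (f : Lat R) (m : ℤ) :
    latY a d f false m = d (m + 1) * f false (m + 1) := rfl

theorem latY_apply_true (f : Lat R) (m : ℤ) :
    latY a d f true m = -(a (m - 1) * f true (m - 1)) := rfl

/-- The basis vector `v_j` or `h v_j`. -/
def basisVec (b : Bool) (j : ℤ) : Lat R := fun b' i => if b' = b ∧ i = j then 1 else 0

/-- The matrix entry of `A` in row `(b', i)` and column `(b, j)`. -/
def entry (A : Module.End R (Lat R)) (b' : Bool) (i : ℤ) (b : Bool) (j : ℤ) : R :=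
  A (basisVec b j) b' i

theorem entry_add (A A' : Module.End R (Lat R)) (b' : Bool) (i : ℤ) (b : Bool) (j : ℤ) :
    entry (A + A') b' i b j = entry A b' i b j + entry A' b' i b j := rfl

theorem entry_one (b' : Bool) (i : ℤ) (b : Bool) (j : ℤ) :
    entry (1 : Module.End R (Lat R)) b' i b j = if b' = b ∧ i = j then 1 else 0 := rfl

theorem entry_mul_of_eq (A : Module.End R (Lat R)) (b' : Bool) (i j : ℤ)
    {B : Module.End R (Lat R)} {b b₁ : Bool} {j₁ : ℤ} {r : R}
    (h : B (basisVec b j) = r • basisVec b₁ j₁) :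
    entry (A * B) b' i b j = r * entry A b' i b₁ j₁ := by
  rw [entry, Module.End.mul_apply, h, map_smul]
  rfl

section

variable {a d} (A : Module.End R (Lat R)) (b' : Bool) (i j : ℤ)

theorem entry_mul_latX_false :
    entry (A * latX a d) b' i false j = a j * entry A b' i false (j + 1) := by
  refine entry_mul_of_eq A b' i j ?_
  ext b m
  cases b
  · simp only [latX_apply_false, basisVec, Pi.smul_apply, smul_eq_mul, true_and]
    by_cases h : m = j + 1
    · simp [h]
    · simp [h, show m - 1 ≠ j by omega]
  · simp [latX_apply_true, basisVec]

theorem entry_mul_latX_true :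
    entry (A * latX a d) b' i true j = d j * entry A b' i true (j - 1) := by
  refine entry_mul_of_eq A b' i j ?_
  ext b m
  cases b
  · simp [latX_apply_false, basisVec]
  · simp only [latX_apply_true, basisVec, Pi.smul_apply, smul_eq_mul, true_and]
    by_cases h : m = j - 1
    · simp [h]
    · simp [h, show m + 1 ≠ j by omega]

theorem entry_mul_latY_false :
    entry (A * latY a d) b' i false j = d j * entry A b' i false (j - 1) := by
  refine entry_mul_of_eq A b' i j ?_
  ext b m
  cases b
  · simp only [latY_apply_false, basisVec, Pi.smul_apply, smul_eq_mul, true_and]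
    by_cases h : m = j - 1
    · simp [h]
    · simp [h, show m + 1 ≠ j by omega]
  · simp [latY_apply_true, basisVec]

theorem entry_mul_latY_true :
    entry (A * latY a d) b' i true j = -(a j * entry A b' i true (j + 1)) := by
  rw [← neg_mul]
  refine entry_mul_of_eq A b' i j ?_
  ext b m
  cases b
  · simp [latY_apply_false, basisVec]
  · simp only [latY_apply_true, basisVec, Pi.smul_apply, smul_eq_mul, true_and]
    by_cases h : m = j + 1
    · simp [h]
    · simp [h, show m - 1 ≠ j by omega]

end

variable [Algebra ℂ R] (j₀ : ℤ)

/-- The action of `h`, with `h h v_m = (-1) ^ (m + j₀) v_m`. -/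
def latH : Module.End R (Lat R) where
  toFun f b m := bif b then f false m else algebraMap ℂ R (((-1) ^ (m + j₀) : ℂˣ) : ℂ) * f true m
  map_add' f f' := by ext b m; cases b <;> simp [mul_add]
  map_smul' r f := by ext b m; cases b <;> simp [mul_left_comm]

/-- The exponent `k` such that `diag (u, u⁻¹)` acts by `u ^ k` on a basis vector. -/
def latExp (b : Bool) (m : ℤ) : ℤ := bif b then -(m + j₀) else m + j₀

/-- The action of the diagonal torus. -/
def latD : ℂˣ →* Module.End R (Lat R) where
  toFun u :=
    { toFun := fun f b m => algebraMap ℂ R ((u ^ latExp j₀ b m : ℂˣ) : ℂ) * f b m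
      map_add' := fun f f' => by ext b m; simp [mul_add]
      map_smul' := fun r f => by ext b m; simp [mul_left_comm] }
  map_one' := by ext f b m; simp
  map_mul' u v := by ext f b m; simp [mul_zpow, mul_assoc]

theorem latH_apply_false (f : Lat R) (m : ℤ) :
    latH j₀ f false m = algebraMap ℂ R (((-1) ^ (m + j₀) : ℂˣ) : ℂ) * f true m := rfl

theorem latH_apply_true (f : Lat R) (m : ℤ) : latH j₀ f true m = f false m := rfl

theorem latD_apply (u : ℂˣ) (f : Lat R) (b : Bool) (m : ℤ) :
    latD j₀ u f b m = algebraMap ℂ R ((u ^ latExp j₀ b m : ℂˣ) : ℂ) * f b m := rfl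

/-- The induced representation as torus data. -/
def latTorus : TorusData (Module.End R (Lat R)) where
  X := latX a d
  Y := latY a d
  h := latH j₀
  D := latD j₀
  D_mul_X u := by
    refine LinearMap.ext fun f => funext₂ fun b m => ?_
    rw [LinearMap.smul_apply, Pi.smul_apply, Pi.smul_apply, Algebra.smul_def]
    cases b
    · simp only [Module.End.mul_apply, latD_apply, latX_apply_false, latExp, cond_false]
      have e : m + j₀ = 1 + (m - 1 + j₀) := by ring
      rw [e, zpow_add, zpow_one, Units.val_mul, map_mul]
      ring
    · simp only [Module.End.mul_apply, latD_apply, latX_apply_true, latExp, cond_true]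
      have e : -(m + j₀) = 1 + -(m + 1 + j₀) := by ring
      rw [e, zpow_add, zpow_one, Units.val_mul, map_mul]
      ring
  D_mul_Y u := by
    refine LinearMap.ext fun f => funext₂ fun b m => ?_
    rw [LinearMap.smul_apply, Pi.smul_apply, Pi.smul_apply, Algebra.smul_def]
    cases b
    · simp only [Module.End.mul_apply, latD_apply, latY_apply_false, latExp, cond_false]
      have e : m + j₀ = -1 + (m + 1 + j₀) := by ring
      rw [e, zpow_add, zpow_neg_one, Units.val_mul, map_mul]
      ring
    · simp only [Module.End.mul_apply, latD_apply, latY_apply_true, latExp, cond_true]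
      have e : -(m + j₀) = -1 + -(m - 1 + j₀) := by ring
      rw [e, zpow_add, zpow_neg_one, Units.val_mul, map_mul]
      ring
  h_mul_D u := by
    refine LinearMap.ext fun f => funext₂ fun b m => ?_
    cases b
    · simp only [Module.End.mul_apply, latD_apply, latH_apply_false, latExp, cond_false, cond_true,
        inv_zpow, zpow_neg]
      ring
    · simp only [Module.End.mul_apply, latD_apply, latH_apply_true, latExp, cond_false, cond_true,
        inv_zpow, zpow_neg, inv_inv]
  h_mul_h := by
    refine LinearMap.ext fun f => funext₂ fun b m => ?_
    cases b
    · simp only [Module.End.mul_apply, latD_apply, latH_apply_false, latH_apply_true, latExp,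
        cond_false]
    · simp only [Module.End.mul_apply, latD_apply, latH_apply_false, latH_apply_true, latExp,
        cond_true, zpow_neg, ← inv_zpow, inv_neg_one]
  h_mul_X := by
    refine LinearMap.ext fun f => funext₂ fun b m => ?_
    cases b
    · simp only [Module.End.mul_apply, LinearMap.neg_apply, Pi.neg_apply, latH_apply_false,
        latX_apply_true, latY_apply_false]
      have e : m + 1 + j₀ = m + j₀ + 1 := by ring
      rw [e, zpow_add_one]
      simp
      ring
    · simp only [Module.End.mul_apply, LinearMap.neg_apply, Pi.neg_apply, latH_apply_true,
        latX_apply_false, latY_apply_true, neg_neg]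
  h_mul_Y := by
    refine LinearMap.ext fun f => funext₂ fun b m => ?_
    cases b
    · simp only [Module.End.mul_apply, latH_apply_false, latY_apply_true, latX_apply_false]
      have e : m + j₀ = m - 1 + j₀ + 1 := by ring
      rw [e, zpow_add_one]
      simp
      ring
    · simp only [Module.End.mul_apply, latH_apply_true, latY_apply_false, latX_apply_true]

/-- The relation `x y - y x = c`, as a relation between the structure constants `a` and `d`. -/
theorem latTorus_comm {n : ℕ} (hn : 0 < n) {c : MonoidAlgebra ℂ (dicyclic n)}
    (hcent : c ∈ Subalgebra.center ℂ (MonoidAlgebra ℂ (dicyclic n)))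
    (hc : ∀ γ : dicyclic n, c.coeff γ ≠ 0 → (γ : SL(2, ℂ)) ∈ Subgroup.zpowers (gMat n))
    (had : ∀ m, a (m - 1) * d m - d (m + 1) * a m = algebraMap ℂ R (weight c (m + j₀))) :
    (latTorus a d j₀).X * (latTorus a d j₀).Y - (latTorus a d j₀).Y * (latTorus a d j₀).X =
      c.coeff.sum fun γ z => z • (latTorus a d j₀).D (entryUnit (γ : SL(2, ℂ))) := by
  have hw : ∀ b m, weight c (latExp j₀ b m) = weight c (m + j₀) := by
    intro b m
    cases b
    · rfl
    · exact weight_neg hn hcent hc _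
  refine LinearMap.ext fun f => funext₂ fun b m => ?_
  have hr : (c.coeff.sum fun γ z => z • (latTorus a d j₀).D (entryUnit (γ : SL(2, ℂ)))) f b m =
      algebraMap ℂ R (weight c (m + j₀)) * f b m := by
    rw [← hw b m, weight, Finsupp.sum, Finsupp.sum, LinearMap.sum_apply, Finset.sum_apply,
      Finset.sum_apply, map_sum, Finset.sum_mul]
    refine Finset.sum_congr rfl fun γ _ => ?_
    rw [LinearMap.smul_apply, Pi.smul_apply, Pi.smul_apply, Algebra.smul_def, map_mul, mul_assoc]
    rfl
  rw [hr, ← had]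
  cases b
  · simp only [latTorus, LinearMap.sub_apply, Pi.sub_apply, Module.End.mul_apply, latX_apply_false,
      latY_apply_false, sub_add_cancel, add_sub_cancel_right]
    ring
  · simp only [latTorus, LinearMap.sub_apply, Pi.sub_apply, Module.End.mul_apply, latX_apply_true,
      latY_apply_true, sub_add_cancel, add_sub_cancel_right]
    ring

variable {a d j₀} (A : Module.End R (Lat R)) (b' : Bool) (i j : ℤ)

theorem entry_smul (z : ℂ) (b : Bool) : entry (z • A) b' i b j = z • entry A b' i b j := rfl

theorem entry_mul_latH_false : entry (A * latH j₀) b' i false j = entry A b' i true j := by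
  rw [← one_mul (entry A b' i true j)]
  refine entry_mul_of_eq A b' i j ?_
  ext b m
  cases b
  · simp [latH_apply_false, basisVec]
  · simp [latH_apply_true, basisVec]

theorem entry_mul_latH_true : entry (A * latH j₀) b' i true j =
    algebraMap ℂ R (((-1) ^ (j + j₀) : ℂˣ) : ℂ) * entry A b' i false j := by
  refine entry_mul_of_eq A b' i j ?_
  ext b m
  cases b
  · by_cases h : m = j
    · simp [latH_apply_false, basisVec, h]
    · simp [latH_apply_false, basisVec, h]
  · simp [latH_apply_true, basisVec]

theorem entry_mul_latD (u : ℂˣ) (b : Bool) : entry (A * latD j₀ u) b' i b j =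
    algebraMap ℂ R ((u ^ latExp j₀ b j : ℂˣ) : ℂ) * entry A b' i b j := by
  refine entry_mul_of_eq A b' i j ?_
  ext b₁ m
  by_cases h : b₁ = b ∧ m = j
  · simp [latD_apply, basisVec, h]
  · simp [latD_apply, basisVec, h]

theorem entry_latD (u : ℂˣ) (b' b : Bool) (i j : ℤ) : entry (latD (R := R) j₀ u) b' i b j =
    algebraMap ℂ R ((u ^ latExp j₀ b j : ℂˣ) : ℂ) * if b' = b ∧ i = j then 1 else 0 := by
  rw [← one_mul (latD (R := R) j₀ u), entry_mul_latD]
  rfl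

end Lattice

/-! ### Potentials of sequences indexed by the integers -/

section Potential

theorem exists_potential (f : ℤ → ℂ) : ∃ q : ℤ → ℂ, ∀ m, q (m + 1) - q m = f m := by
  refine ⟨fun m => ∑ i ∈ Finset.range m.toNat, f i -
    ∑ i ∈ Finset.range (-m).toNat, f (-(i + 1 : ℕ)), fun m => ?_⟩
  obtain ⟨k, rfl | rfl⟩ := m.eq_nat_or_neg
  · have h1 : (-((k : ℤ) + 1)).toNat = 0 := by omega
    have h2 : (-(k : ℤ)).toNat = 0 := by omega
    have h3 : ((k : ℤ) + 1).toNat = k + 1 := by omega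
    simp only [h1, h2, h3, Int.toNat_natCast, Finset.sum_range_succ, Finset.range_zero,
      Finset.sum_empty]
    ring
  · cases k with
    | zero => simp
    | succ k =>
      have h1 : (-((k + 1 : ℕ) : ℤ) + 1).toNat = 0 := by omega
      have h2 : (-((k + 1 : ℕ) : ℤ)).toNat = 0 := by omega
      have h3 : (-(-((k + 1 : ℕ) : ℤ) + 1)).toNat = k := by omega
      have h4 : (-(-((k + 1 : ℕ) : ℤ))).toNat = k + 1 := by omega
      simp only [h1, h2, h3, h4, Finset.sum_range_succ, Finset.range_zero, Finset.sum_empty]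
      ring

theorem eq_of_step {f : ℤ → ℂ} (h : ∀ m, f (m + 1) = f m) (m : ℤ) : f m = f 0 := by
  induction m using Int.induction_on with
  | zero => rfl
  | succ i ih => rw [h, ih]
  | pred i ih =>
    have := h (-(i : ℤ) - 1)
    rw [sub_add_cancel] at this
    rw [← this, ih]

theorem exists_antisymm_potential {f : ℤ → ℂ} (hf : ∀ m, f (-m) = f m) :
    ∃ p : ℤ → ℂ, (∀ m, p m - p (m + 1) = f m) ∧ ∀ m, p (-m) = -p (m + 1) := by
  obtain ⟨q, hq⟩ := exists_potential f
  refine ⟨fun m => (q 0 + q 1) / 2 - q m, fun m => by linear_combination hq m, fun m => ?_⟩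
  have h := eq_of_step (f := fun m => q (-m) + q (m + 1)) (fun m => by
    have h1 := hq (-(m + 1))
    have h2 := hq (m + 1)
    have h3 := hf (m + 1)
    rw [show -(m + 1) + 1 = -m by ring] at h1
    linear_combination h2 - h1 - h3) m
  simp only [neg_zero, zero_add] at h
  linear_combination -h

end Potential

/-! ### Traces concentrated on `diag (u, u⁻¹) h` -/

section Sign

/-- The sign `(-1) ^ k`. -/
def sgn (k : ℤ) : ℂ := (((-1) ^ k : ℂˣ) : ℂ)

theorem sgn_add_one (k : ℤ) : sgn (k + 1) = -sgn k := by
  rw [sgn, zpow_add_one]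
  simp [sgn]

theorem sgn_neg (k : ℤ) : sgn (-k) = sgn k := by
  rw [sgn, zpow_neg, ← inv_zpow, inv_neg_one, sgn]

theorem sgn_add (k l : ℤ) : sgn (k + l) = sgn k * sgn l := by
  rw [sgn, zpow_add, Units.val_mul, sgn, sgn]

theorem sgn_zero : sgn 0 = 1 := rfl

theorem sgn_mul_self (k : ℤ) : sgn k * sgn k = 1 := by
  nth_rw 1 [← sgn_neg]
  rw [← sgn_add, neg_add_cancel, sgn_zero]

end Sign

section Band

/-- The operators whose matrix vanishes outside a band around the diagonal. -/
def bandSubmodule : Submodule ℂ (Module.End ℂ (Lat ℂ)) where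
  carrier := {A | ∃ N : ℤ, ∀ b' i b j, N < |i - j| → entry A b' i b j = 0}
  zero_mem' := ⟨0, fun _ _ _ _ _ => rfl⟩
  add_mem' := by
    rintro A A' ⟨N, h⟩ ⟨N', h'⟩
    refine ⟨max N N', fun b' i b j hij => ?_⟩
    rw [entry_add, h _ _ _ _ ((le_max_left _ _).trans_lt hij),
      h' _ _ _ _ ((le_max_right _ _).trans_lt hij), add_zero]
  smul_mem' := by
    rintro z A ⟨N, h⟩
    exact ⟨N, fun b' i b j hij => by rw [entry_smul, h _ _ _ _ hij, smul_zero]⟩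

variable (a d : ℤ → ℂ) (j₀ : ℤ) {A : Module.End ℂ (Lat ℂ)}

theorem one_mem_band : (1 : Module.End ℂ (Lat ℂ)) ∈ bandSubmodule := by
  refine ⟨0, fun b' i b j hij => ?_⟩
  rw [entry_one, if_neg]
  rintro ⟨-, rfl⟩
  simp at hij

theorem latX_mul_mem_band (hA : A ∈ bandSubmodule) : latX a d * A ∈ bandSubmodule := by
  obtain ⟨N, h⟩ := hA
  refine ⟨N + 1, fun b' i b j hij => ?_⟩
  have h1 : N < |i - 1 - j| := by grind
  have h2 : N < |i + 1 - j| := by grind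
  cases b'
  · exact (congrArg _ (h false (i - 1) b j h1)).trans (mul_zero _)
  · exact (congrArg _ (h true (i + 1) b j h2)).trans (mul_zero _)

theorem latY_mul_mem_band (hA : A ∈ bandSubmodule) : latY a d * A ∈ bandSubmodule := by
  obtain ⟨N, h⟩ := hA
  refine ⟨N + 1, fun b' i b j hij => ?_⟩
  have h1 : N < |i - 1 - j| := by grind
  have h2 : N < |i + 1 - j| := by grind
  cases b'
  · exact (congrArg _ (h false (i + 1) b j h2)).trans (mul_zero _)
  · exact neg_eq_zero.2 ((congrArg _ (h true (i - 1) b j h1)).trans (mul_zero _))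

theorem latD_mul_mem_band (u : ℂˣ) (hA : A ∈ bandSubmodule) : latD j₀ u * A ∈ bandSubmodule := by
  obtain ⟨N, h⟩ := hA
  exact ⟨N, fun b' i b j hij => (congrArg _ (h b' i b j hij)).trans (mul_zero _)⟩

theorem latH_mul_mem_band (hA : A ∈ bandSubmodule) : latH j₀ * A ∈ bandSubmodule := by
  obtain ⟨N, h⟩ := hA
  refine ⟨N, fun b' i b j hij => ?_⟩
  cases b'
  · exact (congrArg _ (h true i b j hij)).trans (mul_zero _)
  · exact h false i b j hij

variable (θ : ℤ → ℂ)

/-- The sum of the matrix entries that exchange `v_m` and `h v_{-m}`, weighted by `θ`. If `v_m ↦ θ_m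
v_{-m}` commutes with `x` and `y` up to the substitution by `h`, this is the trace of the product
with that map. For a band matrix the sum is finite. -/
def antiTrace (A : Module.End ℂ (Lat ℂ)) : ℂ :=
  ∑ᶠ m, sgn (m + j₀) * θ m * entry A false m true (-m) + ∑ᶠ m, θ m * entry A true m false (-m)

theorem antiTrace_summand_finite (hA : A ∈ bandSubmodule) (κ : ℤ → ℂ) (b' b : Bool) :
    (Function.support fun m => κ m * entry A b' m b (-m)).Finite := by
  obtain ⟨N, h⟩ := hA
  refine (Set.finite_Icc (-N) N).subset fun m hm => ?_
  by_contra hm'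
  refine hm ?_
  have : N < |m - -m| := by
    rw [Set.mem_Icc] at hm'
    grind
  simp only [h _ _ _ _ this, mul_zero]

theorem antiTrace_add {A' : Module.End ℂ (Lat ℂ)} (hA : A ∈ bandSubmodule)
    (hA' : A' ∈ bandSubmodule) :
    antiTrace j₀ θ (A + A') = antiTrace j₀ θ A + antiTrace j₀ θ A' := by
  simp only [antiTrace, entry_add, mul_add]
  rw [finsum_add_distrib (antiTrace_summand_finite hA _ _ _) (antiTrace_summand_finite hA' _ _ _),
    finsum_add_distrib (antiTrace_summand_finite hA _ _ _) (antiTrace_summand_finite hA' _ _ _)]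
  ring

theorem antiTrace_smul (z : ℂ) : antiTrace j₀ θ (z • A) = z * antiTrace j₀ θ A := by
  rw [antiTrace, antiTrace, mul_add, ← smul_eq_mul z, ← smul_eq_mul z, smul_finsum, smul_finsum]
  simp only [entry_smul, mul_smul_comm]

theorem finsum_shift (f : ℤ → ℂ) (k : ℤ) : ∑ᶠ m, f (m + k) = ∑ᶠ m, f m :=
  finsum_comp_equiv (Equiv.addRight k)

variable {a d j₀ θ}

theorem antiTrace_latX (h1 : ∀ m, θ (m + 1) * a m = -(d (-m) * θ m))
    (h2 : ∀ m, θ (m - 1) * d m = a (-m) * θ m) (A : Module.End ℂ (Lat ℂ)) :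
    antiTrace j₀ θ (latX a d * A) = antiTrace j₀ θ (A * latX a d) := by
  rw [antiTrace, antiTrace]
  congr 1
  · rw [← finsum_shift _ 1]
    refine finsum_congr fun m => ?_
    rw [entry_mul_latX_true]
    change sgn (m + 1 + j₀) * θ (m + 1) * (a (m + 1 - 1) * entry A false (m + 1 - 1) true _) = _
    rw [add_sub_cancel_right, show m + 1 + j₀ = m + j₀ + 1 by ring, sgn_add_one, neg_add,
      ← sub_eq_add_neg]
    linear_combination -sgn (m + j₀) * entry A false m true (-m - 1) * h1 m
  · rw [← finsum_shift _ (-1)]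
    refine finsum_congr fun m => ?_
    rw [entry_mul_latX_false]
    change θ (m + -1) * (d (m + -1 + 1) * entry A true (m + -1 + 1) false _) = _
    rw [neg_add_cancel_right, ← sub_eq_add_neg, neg_sub, show 1 - m = -m + 1 by ring]
    linear_combination entry A true m false (-m + 1) * h2 m

theorem antiTrace_latY (h1 : ∀ m, θ (m + 1) * a m = -(d (-m) * θ m))
    (h2 : ∀ m, θ (m - 1) * d m = a (-m) * θ m) (A : Module.End ℂ (Lat ℂ)) :
    antiTrace j₀ θ (latY a d * A) = antiTrace j₀ θ (A * latY a d) := by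
  rw [antiTrace, antiTrace]
  congr 1
  · rw [← finsum_shift _ (-1)]
    refine finsum_congr fun m => ?_
    rw [entry_mul_latY_true]
    change sgn (m + -1 + j₀) * θ (m + -1) * (d (m + -1 + 1) * entry A false (m + -1 + 1) true _) = _
    have h3 : sgn (m + j₀) = -sgn (m - 1 + j₀) := by rw [← sgn_add_one]; congr 1; ring
    rw [neg_add_cancel_right, ← sub_eq_add_neg, neg_sub, show 1 - m = -m + 1 by ring, h3]
    linear_combination sgn (m - 1 + j₀) * entry A false m true (-m + 1) * h2 m
  · rw [← finsum_shift _ 1]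
    refine finsum_congr fun m => ?_
    rw [entry_mul_latY_false]
    change θ (m + 1) * -(a (m + 1 - 1) * entry A true (m + 1 - 1) false _) = _
    rw [add_sub_cancel_right, neg_add, ← sub_eq_add_neg]
    linear_combination -entry A true m false (-m - 1) * h1 m

theorem antiTrace_latD {u : ℂˣ} (hu : u ^ (2 * j₀) = 1) (A : Module.End ℂ (Lat ℂ)) :
    antiTrace j₀ θ (latD j₀ u * A) = antiTrace j₀ θ (A * latD j₀ u) := by
  have h : ∀ m, u ^ (m + j₀) = u ^ (-(-m + j₀)) := by
    intro m
    rw [show m + j₀ = -(-m + j₀) + 2 * j₀ by ring, zpow_add, hu, mul_one]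
  have h' : ∀ m, u ^ (-(m + j₀)) = u ^ (-m + j₀) := by
    intro m
    rw [show -m + j₀ = -(m + j₀) + 2 * j₀ by ring, zpow_add, hu, mul_one]
  rw [antiTrace, antiTrace]
  congr 1 <;> refine finsum_congr fun m => ?_ <;> rw [entry_mul_latD]
  · change _ * (((u ^ (m + j₀) : ℂˣ) : ℂ) * _) = _ * (((u ^ (-(-m + j₀)) : ℂˣ) : ℂ) * _)
    rw [h]
    rfl
  · change _ * (((u ^ (-(m + j₀)) : ℂˣ) : ℂ) * _) = _ * (((u ^ (-m + j₀) : ℂˣ) : ℂ) * _)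
    rw [h']
    rfl

theorem antiTrace_latH (A : Module.End ℂ (Lat ℂ)) :
    antiTrace j₀ θ (latH j₀ * A) = antiTrace j₀ θ (A * latH j₀) := by
  have h : ∀ m, sgn (-m + j₀) = sgn (m + j₀) := by
    intro m
    rw [sgn_add, sgn_add, sgn_neg]
  rw [antiTrace, antiTrace, add_comm]
  congr 1 <;> refine finsum_congr fun m => ?_
  · rw [entry_mul_latH_true]
    change θ m * entry A false m false (-m) =
      sgn (m + j₀) * θ m * (sgn (-m + j₀) * entry A false m false (-m))
    rw [h]
    linear_combination -θ m * entry A false m false (-m) * sgn_mul_self (m + j₀)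
  · rw [entry_mul_latH_false]
    change sgn (m + j₀) * θ m * (sgn (m + j₀) * entry A true m true (-m)) =
      θ m * entry A true m true (-m)
    linear_combination θ m * entry A true m true (-m) * sgn_mul_self (m + j₀)

theorem antiTrace_diag (u : ℂˣ) : antiTrace j₀ θ (latD j₀ u) = 0 := by
  simp [antiTrace, entry_latD]

theorem antiTrace_diag_mul (hθ : θ 0 = 1) {u : ℂˣ} (hu : u ^ (2 * j₀) = 1) :
    antiTrace j₀ θ (latD j₀ u * latH j₀) = 2 * ((u ^ j₀ : ℂˣ) : ℂ) := by
  have hu' : u ^ (-j₀) = u ^ j₀ := by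
    rw [← mul_one (u ^ (-j₀)), ← hu, ← zpow_add]
    congr 1
    ring
  rw [antiTrace, finsum_eq_single _ 0, finsum_eq_single _ 0]
  · rw [neg_zero, entry_mul_latH_false, entry_mul_latH_true, entry_latD, entry_latD]
    change sgn (0 + j₀) * θ 0 * (sgn (0 + j₀) * (((u ^ (0 + j₀) : ℂˣ) : ℂ) * _)) +
      θ 0 * (((u ^ (-(0 + j₀)) : ℂˣ) : ℂ) * _) = _
    rw [zero_add, hu', hθ, if_pos ⟨rfl, rfl⟩, if_pos ⟨rfl, rfl⟩]
    linear_combination ((u ^ j₀ : ℂˣ) : ℂ) * sgn_mul_self j₀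
  · intro m hm
    rw [entry_mul_latH_false, entry_latD, if_neg (by omega), mul_zero, mul_zero]
  · intro m hm
    rw [entry_mul_latH_true, entry_latD, if_neg (by omega), mul_zero, mul_zero, mul_zero]

end Band

/-- If `n` divides `2 j₀`, the weight module with weights `m + j₀` is carried to itself by `h`,
acting on the weights by `m ↦ -m`. The trace of `a h` on this module is a finite sum, and defines a
trace on `H_c`. The structure constants are normalized so that `x` raises `v_m` with coefficient `1`
for `m ≥ 0` and `y` lowers it with coefficient `1` for `m ≤ 0`; this allows zeros of the potential
`p`. -/
theorem exists_trace_antidiagonal {n : ℕ} (hn : 0 < n) (hn_even : Even n)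
    {c : MonoidAlgebra ℂ (dicyclic n)}
    (hcent : c ∈ Subalgebra.center ℂ (MonoidAlgebra ℂ (dicyclic n)))
    (hc : ∀ γ : dicyclic n, c.coeff γ ≠ 0 → (γ : SL(2, ℂ)) ∈ Subgroup.zpowers (gMat n))
    {j₀ : ℤ} (hj : (n : ℤ) ∣ 2 * j₀) :
    ∃ T ∈ traces (H (dicyclic n) c),
      (∀ (γ : dicyclic n) (u : ℂˣ), (γ : SL(2, ℂ)) = diagSL u →
        T ((universal (dicyclic n) c).grp γ) = 0) ∧
      ∀ (γ : dicyclic n) (u : ℂˣ), u ^ n = 1 → (γ : SL(2, ℂ)) = diagSL u * hMat →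
        T ((universal (dicyclic n) c).grp γ) = 2 * ((u ^ j₀ : ℂˣ) : ℂ) := by
  have hper : ∀ (k m : ℤ), weight c (m + n * k) = weight c m := by
    intro k m
    have h := eq_of_step (f := fun k => weight c (m + n * k)) (fun k => by
      have := weight_add_period hn hc (m + n * k)
      rw [← this]
      congr 1
      ring) k
    simpa using h
  have hu : ∀ u : ℂˣ, u ^ n = 1 → u ^ (2 * j₀) = 1 := by
    intro u hu
    obtain ⟨k, hk⟩ := hj
    rw [hk, zpow_mul, zpow_natCast, hu, one_zpow]
  have hsym : ∀ m, weight c (-m + j₀) = weight c (m + j₀) := by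
    intro m
    obtain ⟨k, hk⟩ := hj
    rw [← weight_neg hn hcent hc (m + j₀), ← hper k (-(m + j₀)), ← hk]
    congr 1
    ring
  obtain ⟨p, hp, hp'⟩ := exists_antisymm_potential (f := fun m => weight c (m + j₀)) hsym
  set a : ℤ → ℂ := fun m => if 0 ≤ m then 1 else p (m + 1) with ha
  set d : ℤ → ℂ := fun m => if 1 ≤ m then p m else 1 with hd
  set θ : ℤ → ℂ := fun m => if 0 ≤ m then sgn m else 1 with hθ
  have had : ∀ m, a (m - 1) * d m - d (m + 1) * a m = weight c (m + j₀) := by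
    intro m
    rw [← hp m]
    simp only [ha, hd]
    rcases lt_trichotomy m 0 with h | rfl | h
    · rw [if_neg (by omega), if_neg (by omega), if_neg (by omega), if_neg (by omega)]
      simp
    · simp
    · rw [if_pos (by omega), if_pos (by omega), if_pos (by omega), if_pos (by omega)]
      simp
  have h1 : ∀ m, θ (m + 1) * a m = -(d (-m) * θ m) := by
    intro m
    simp only [ha, hd, hθ]
    rcases lt_or_ge m 0 with h | h
    · have hs : (if 0 ≤ m + 1 then sgn (m + 1) else 1) = 1 := by
        split_ifs with h'
        · rw [show m + 1 = 0 by omega, sgn_zero]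
        · rfl
      rw [hs, if_neg (by omega), if_pos (by omega), if_neg (by omega), hp']
      ring
    · rw [if_pos (by omega), if_pos h, if_neg (by omega), if_pos h, sgn_add_one]
      ring
  have h2 : ∀ m, θ (m - 1) * d m = a (-m) * θ m := by
    intro m
    simp only [ha, hd, hθ]
    rcases lt_or_ge 0 m with h | h
    · have h3 := sgn_add_one (m - 1)
      have h4 := hp' (m - 1)
      rw [sub_add_cancel] at h3 h4
      rw [neg_sub] at h4
      rw [if_pos (by omega), if_pos (by omega), if_neg (by omega), if_pos (by omega), h3,
        show -m + 1 = 1 - m by ring, h4]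
      ring
    · have hs : (if 0 ≤ m then sgn m else 1) = 1 := by
        split_ifs with h'
        · rw [show m = 0 by omega, sgn_zero]
        · rfl
      rw [hs, if_neg (by omega), if_neg (by omega), if_pos (by omega)]
  obtain ⟨T, hT, hT'⟩ := (latTorus a d j₀).exists_trace hn hn_even hc
    (latTorus_comm a d j₀ hn hcent hc had) bandSubmodule one_mem_band
    (fun w hw => latX_mul_mem_band a d hw) (fun w hw => latY_mul_mem_band a d hw)
    (fun u _ w hw => latD_mul_mem_band j₀ u hw) (fun w hw => latH_mul_mem_band j₀ hw)
    (antiTrace j₀ θ) (fun w hw w' hw' => antiTrace_add j₀ θ hw hw')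
    (fun z w _ => antiTrace_smul j₀ θ z) (fun w _ => antiTrace_latX h1 h2 w)
    (fun w _ => antiTrace_latY h1 h2 w) (fun u h w _ => antiTrace_latD (hu u h) w)
    (fun w _ => antiTrace_latH w)
  refine ⟨T, hT, fun γ u h => ?_, fun γ u hu' h => ?_⟩
  · rw [hT', h, TorusData.grpFun_diagSL]
    exact antiTrace_diag u
  · rw [hT', h, TorusData.grpFun_diagSL_mul_hMat]
    exact antiTrace_diag_mul (by simp [hθ, sgn_zero]) (hu u hu')

/-! ### Functionals on polynomials that regularize a divergent trace -/

section Functional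

open Polynomial

/-- A polynomial with a nonzero period is constant. -/
theorem eq_C_of_taylor_eq {τ : ℂ} (hτ : τ ≠ 0) {Q : ℂ[X]} (h : taylor (-τ) Q = Q) :
    Q = C (Q.eval 0) := by
  have hk : ∀ k : ℕ, Q.eval (k * τ) = Q.eval 0 := by
    intro k
    induction k with
    | zero => simp
    | succ k ih =>
      rw [← ih]
      nth_rw 1 [← h]
      rw [taylor_eval]
      congr 1
      push_cast
      ring
  refine eq_of_infinite_eval_eq _ _ (Set.infinite_of_injective_forall_mem
    (f := fun k : ℕ => (k * τ : ℂ)) ?_ fun k => ?_)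
  · intro k l hkl
    exact Nat.cast_injective (mul_right_cancel₀ hτ hkl)
  · rw [Set.mem_ofPred_eq, hk, eval_C]

/-- The difference operator `Q ↦ Q - Q(· - τ)` has only the constants in its kernel, so a functional
that vanishes on the constants factors through it. -/
theorem exists_functional {τ : ℂ} (hτ : τ ≠ 0) (L : ℂ[X] →ₗ[ℂ] ℂ) (hL : L 1 = 0) :
    ∃ Λ : ℂ[X] →ₗ[ℂ] ℂ, ∀ Q, Λ Q - Λ (taylor (-τ) Q) = L Q := by
  set D : ℂ[X] →ₗ[ℂ] ℂ[X] := LinearMap.id - taylor (-τ) with hD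
  have h : L ∈ LinearMap.range D.dualMap := by
    rw [LinearMap.range_dualMap_eq_dualAnnihilator_ker, Submodule.mem_dualAnnihilator]
    intro Q hQ
    have hQ' : taylor (-τ) Q = Q := (sub_eq_zero.1 (LinearMap.mem_ker.1 hQ)).symm
    rw [eq_C_of_taylor_eq hτ hQ', ← mul_one (C _), ← smul_eq_C_mul, map_smul, hL, smul_zero]
  obtain ⟨Λ, hΛ⟩ := h
  refine ⟨Λ, fun Q => ?_⟩
  rw [← map_sub, ← hΛ]
  rfl

/-- Functionals `Λ_j` whose increments are multiples of the evaluations at `q_j`, that are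
quasi-periodic, and whose values on constants are prescribed up to a common summand. -/
theorem exists_functional_sequence {τ : ℂ} (hτ : τ ≠ 0) (q : ℕ → ℂ) {n : ℕ} {l : ℕ → ℂ}
    (hl : l n = l 0) : ∃ Λ : ℕ → ℂ[X] →ₗ[ℂ] ℂ,
      (∀ j Q, Q.eval (q (j + 1)) = 0 → Λ (j + 1) Q = Λ j Q) ∧
      (∀ Q, Λ n (taylor (-τ) Q) = Λ 0 Q) ∧ ∃ κ, ∀ j z, Λ j (C z) = z * (κ + l j) := by
  obtain ⟨Λ, hΛ⟩ := exists_functional hτ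
    ((∑ i ∈ Finset.range n, (l (i + 1) - l i) • leval (q (i + 1))) ∘ₗ taylor (-τ)) (by
      have h : taylor (-τ) (1 : ℂ[X]) = 1 := taylor_one _
      rw [LinearMap.comp_apply, h, LinearMap.sum_apply]
      simp only [LinearMap.smul_apply, leval_apply, eval_one, smul_eq_mul, mul_one]
      rw [Finset.sum_range_sub, hl, sub_self])
  refine ⟨fun j => Λ + ∑ i ∈ Finset.range j, (l (i + 1) - l i) • leval (q (i + 1)), ?_, ?_,
    Λ 1 - l 0, ?_⟩
  · intro j Q hQ
    simp only [Finset.sum_range_succ, LinearMap.add_apply, LinearMap.smul_apply, leval_apply, hQ,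
      smul_zero, add_zero]
  · intro Q
    have h := hΛ Q
    rw [LinearMap.comp_apply] at h
    change _ = (∑ i ∈ Finset.range n, (l (i + 1) - l i) • leval (q (i + 1))) (taylor (-τ) Q) at h
    rw [LinearMap.add_apply, ← h]
    simp
  · intro j z
    rw [← mul_one (C z), ← smul_eq_C_mul, map_smul, LinearMap.add_apply, LinearMap.sum_apply]
    simp only [LinearMap.smul_apply, leval_apply, eval_one, smul_eq_mul, mul_one]
    rw [Finset.sum_range_sub]
    ring

theorem sum_functional_shift {τ : ℂ} {q : ℕ → ℂ} {n : ℕ} {Λ : ℕ → ℂ[X] →ₗ[ℂ] ℂ}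
    (h1 : ∀ j Q, Q.eval (q (j + 1)) = 0 → Λ (j + 1) Q = Λ j Q)
    (h2 : ∀ Q, Λ n (taylor (-τ) Q) = Λ 0 Q) {B : ℕ → ℂ[X]}
    (hB : ∀ j, (B (j + 1)).eval (q (j + 1)) = 0) (hBn : B n = taylor (-τ) (B 0)) :
    ∑ j ∈ Finset.range n, Λ j (B j) = ∑ j ∈ Finset.range n, Λ j (B (j + 1)) := by
  have h : ∑ j ∈ Finset.range n, (Λ (j + 1) (B (j + 1)) - Λ j (B j)) = 0 := by
    rw [Finset.sum_range_sub (fun j => Λ j (B j)), hBn, h2, sub_self]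
  rw [Finset.sum_sub_distrib, sub_eq_zero] at h
  rw [← h]
  exact Finset.sum_congr rfl fun j _ => h1 j _ (hB j)

end Functional

/-! ### Traces concentrated on the cyclic subgroup -/

section Diagonal

open Polynomial

variable (q : ℤ → ℂ) (n : ℕ) (τ : ℂ)

/-- Operators on the induced representation over `ℂ[s]` with the properties that the elements of
`H_c` have there: at `s = q_j` the vectors `v_i`, `h v_i` with `i ≥ j` span a submodule, and the
translation of the indices by `n` amounts to the translation of `s` by `τ`. -/
def vermaSubmodule : Submodule ℂ (Module.End ℂ[X] (Lat ℂ[X])) where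
  carrier := {A | (∀ b' i b j, i < j → (entry A b' i b j).eval (q j) = 0) ∧
    ∀ b' i b j, entry A b' (i + n) b (j + n) = taylor (-τ) (entry A b' i b j)}
  zero_mem' := ⟨fun _ _ _ _ _ => eval_zero, fun _ _ _ _ => (map_zero (taylor (-τ))).symm⟩
  add_mem' := by
    rintro A A' ⟨h, k⟩ ⟨h', k'⟩
    refine ⟨fun b' i b j hij => ?_, fun b' i b j => ?_⟩
    · rw [entry_add, eval_add, h _ _ _ _ hij, h' _ _ _ _ hij, add_zero]
    · rw [entry_add, entry_add, k, k', map_add]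
  smul_mem' := by
    rintro z A ⟨h, k⟩
    refine ⟨fun b' i b j hij => ?_, fun b' i b j => ?_⟩
    · rw [entry_smul, eval_smul, h _ _ _ _ hij, smul_zero]
    · rw [entry_smul, entry_smul, k, map_smul]

variable {q n τ}

theorem one_mem_verma : (1 : Module.End ℂ[X] (Lat ℂ[X])) ∈ vermaSubmodule q n τ := by
  refine ⟨fun b' i b j hij => ?_, fun b' i b j => ?_⟩
  · rw [entry_one, if_neg (fun h => hij.ne h.2), eval_zero]
  · rw [entry_one, entry_one]
    by_cases h : b' = b ∧ i = j
    · rw [if_pos h, if_pos ⟨h.1, by rw [h.2]⟩, taylor_one, C_1]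
    · rw [if_neg h, if_neg fun h' => h ⟨h'.1, by have := h'.2; omega⟩, map_zero]

variable {A : Module.End ℂ[X] (Lat ℂ[X])}

theorem X_sub_C_add_period (hq : ∀ m, q (m + n) = q m + τ) (m : ℤ) :
    (Polynomial.X - C (q (m + n)) : ℂ[X]) = taylor (-τ) (Polynomial.X - C (q m)) := by
  rw [map_sub, taylor_X, taylor_C, hq, C_add, C_neg]
  ring

/-- Left multiplication by a lowering operator, with coefficients `s - q_m`. -/
theorem lower_mem_verma (hq : ∀ m, q (m + n) = q m + τ) (hA : A ∈ vermaSubmodule q n τ)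
    (b' : Bool) (i : ℤ) (b : Bool) (j : ℤ) :
    (i < j → ((Polynomial.X - C (q (i + 1))) * entry A b' (i + 1) b j).eval (q j) = 0) ∧
    (Polynomial.X - C (q (i + n + 1))) * entry A b' (i + n + 1) b (j + n) =
      taylor (-τ) ((Polynomial.X - C (q (i + 1))) * entry A b' (i + 1) b j) := by
  refine ⟨fun hij => ?_, ?_⟩
  · rcases (Int.add_one_le_iff.2 hij).lt_or_eq with h | h
    · rw [eval_mul, hA.1 _ _ _ _ h, mul_zero]
    · rw [h]
      simp
  · rw [taylor_mul, ← hA.2, ← X_sub_C_add_period hq, show i + n + 1 = i + 1 + n by ring]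

/-- Left multiplication by a raising operator, with coefficients `1`. -/
theorem raise_mem_verma (hA : A ∈ vermaSubmodule q n τ) (b' : Bool) (i : ℤ) (b : Bool) (j : ℤ) :
    (i < j → (1 * entry A b' (i - 1) b j).eval (q j) = 0) ∧
    1 * entry A b' (i + n - 1) b (j + n) = taylor (-τ) (1 * entry A b' (i - 1) b j) := by
  rw [one_mul, one_mul]
  refine ⟨fun hij => hA.1 _ _ _ _ (by omega), ?_⟩
  rw [← hA.2, show i + n - 1 = i - 1 + n by ring]

theorem latX_mul_mem_verma (hq : ∀ m, q (m + n) = q m + τ) (hA : A ∈ vermaSubmodule q n τ) :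
    latX (fun _ => 1) (fun m => Polynomial.X - C (q m)) * A ∈ vermaSubmodule q n τ := by
  refine ⟨fun b' i b j => ?_, fun b' i b j => ?_⟩ <;> cases b'
  · exact (raise_mem_verma hA false i b j).1
  · exact (lower_mem_verma hq hA true i b j).1
  · exact (raise_mem_verma hA false i b j).2
  · exact (lower_mem_verma hq hA true i b j).2

theorem latY_mul_mem_verma (hq : ∀ m, q (m + n) = q m + τ) (hA : A ∈ vermaSubmodule q n τ) :
    latY (fun _ => 1) (fun m => Polynomial.X - C (q m)) * A ∈ vermaSubmodule q n τ := by
  refine ⟨fun b' i b j => ?_, fun b' i b j => ?_⟩ <;> cases b'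
  · exact (lower_mem_verma hq hA false i b j).1
  · intro hij
    exact (eval_neg _ _).trans (neg_eq_zero.2 ((raise_mem_verma hA true i b j).1 hij))
  · exact (lower_mem_verma hq hA false i b j).2
  · exact (congrArg _ (raise_mem_verma hA true i b j).2).trans (map_neg _ _).symm

theorem latD_mul_mem_verma {u : ℂˣ} (hu : u ^ n = 1) (hA : A ∈ vermaSubmodule q n τ) :
    latD 0 u * A ∈ vermaSubmodule q n τ := by
  refine ⟨fun b' i b j hij => ?_, fun b' i b j => ?_⟩
  · change (C ((u ^ latExp 0 b' i : ℂˣ) : ℂ) * entry A b' i b j).eval (q j) = 0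
    rw [eval_mul, hA.1 _ _ _ _ hij, mul_zero]
  · have h : u ^ latExp 0 b' (i + n) = u ^ latExp 0 b' i := by
      cases b'
      · simp [latExp, zpow_add, hu]
      · simp [latExp, zpow_add, hu]
    change C ((u ^ latExp 0 b' (i + n) : ℂˣ) : ℂ) * entry A b' (i + n) b (j + n) =
      taylor (-τ) (C ((u ^ latExp 0 b' i : ℂˣ) : ℂ) * entry A b' i b j)
    rw [taylor_mul, taylor_C, h, hA.2]

theorem latH_mul_mem_verma (hn : Even n) (hA : A ∈ vermaSubmodule q n τ) :
    latH 0 * A ∈ vermaSubmodule q n τ := by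
  refine ⟨fun b' i b j hij => ?_, fun b' i b j => ?_⟩ <;> cases b'
  · change (C (sgn (i + 0)) * entry A true i b j).eval (q j) = 0
    rw [eval_mul, hA.1 _ _ _ _ hij, mul_zero]
  · exact hA.1 false i b j hij
  · have h : sgn (i + n + 0) = sgn (i + 0) := by
      have : sgn (n : ℤ) = 1 := by simp [sgn, hn.neg_one_pow]
      rw [add_zero, add_zero, sgn_add, this, mul_one]
    change C (sgn (i + n + 0)) * entry A true (i + n) b (j + n) =
      taylor (-τ) (C (sgn (i + 0)) * entry A true i b j)
    rw [taylor_mul, taylor_C, h, hA.2]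
  · exact hA.2 false i b j

variable (n) in
/-- The sum of the diagonal entries over one period, each evaluated by its functional. -/
def diagTrace (Λ : ℕ → ℂ[X] →ₗ[ℂ] ℂ) (A : Module.End ℂ[X] (Lat ℂ[X])) : ℂ :=
  ∑ j ∈ Finset.range n, Λ j (entry A false j false j) +
    ∑ j ∈ Finset.range n, Λ j (entry A true j true j)

variable {Λ : ℕ → ℂ[X] →ₗ[ℂ] ℂ}

theorem diagTrace_latH (A : Module.End ℂ[X] (Lat ℂ[X])) :
    diagTrace n Λ (latH 0 * A) = diagTrace n Λ (A * latH 0) := by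
  rw [diagTrace, diagTrace, add_comm]
  simp only [entry_mul_latH_false, entry_mul_latH_true]
  rfl

theorem diagTrace_latD (u : ℂˣ) (A : Module.End ℂ[X] (Lat ℂ[X])) :
    diagTrace n Λ (latD 0 u * A) = diagTrace n Λ (A * latD 0 u) := by
  rw [diagTrace, diagTrace]
  simp only [entry_mul_latD]
  rfl

/-- The entries next to the diagonal vanish at `s = q_j`, where the functionals `Λ` jump. -/
theorem sum_raise (h1 : ∀ j Q, Q.eval (q ((j : ℤ) + 1)) = 0 → Λ (j + 1) Q = Λ j Q)
    (h2 : ∀ Q, Λ n (taylor (-τ) Q) = Λ 0 Q)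
    (hA : A ∈ vermaSubmodule q n τ) (b : Bool) :
    ∑ j ∈ Finset.range n, Λ j (1 * entry A b (j - 1) b j) =
      ∑ j ∈ Finset.range n, Λ j (1 * entry A b j b (j + 1)) := by
  have h := sum_functional_shift (q := fun j => q j) (B := fun j => entry A b ((j : ℤ) - 1) b j)
    (fun j Q hQ => h1 j Q (by exact_mod_cast hQ)) h2 (fun j => hA.1 _ _ _ _ (by omega)) (by
      have := hA.2 b (-1) b 0
      rw [zero_add, neg_add_eq_sub] at this
      simpa using this)
  simpa using h

theorem sum_lower (h1 : ∀ j Q, Q.eval (q ((j : ℤ) + 1)) = 0 → Λ (j + 1) Q = Λ j Q)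
    (h2 : ∀ Q, Λ n (taylor (-τ) Q) = Λ 0 Q)
    (hq : ∀ m, q (m + n) = q m + τ) (hA : A ∈ vermaSubmodule q n τ) (b : Bool) :
    ∑ j ∈ Finset.range n, Λ j ((Polynomial.X - C (q (j + 1))) * entry A b (j + 1) b j) =
      ∑ j ∈ Finset.range n, Λ j ((Polynomial.X - C (q j)) * entry A b j b (j - 1)) := by
  have h := sum_functional_shift (q := fun j => q j)
    (B := fun j => (Polynomial.X - C (q j)) * entry A b j b ((j : ℤ) - 1))
    (fun j Q hQ => h1 j Q (by exact_mod_cast hQ)) h2 (fun j => by simp) (by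
      have h3 := hA.2 b 0 b (-1)
      have h4 := X_sub_C_add_period (q := q) (n := n) hq 0
      rw [zero_add, neg_add_eq_sub] at h3
      rw [zero_add] at h4
      simp [h3, h4])
  simpa using h.symm

theorem diagTrace_latX (h1 : ∀ j Q, Q.eval (q ((j : ℤ) + 1)) = 0 → Λ (j + 1) Q = Λ j Q)
    (h2 : ∀ Q, Λ n (taylor (-τ) Q) = Λ 0 Q)
    (hq : ∀ m, q (m + n) = q m + τ) (hA : A ∈ vermaSubmodule q n τ) :
    diagTrace n Λ (latX (fun _ => 1) (fun m => Polynomial.X - C (q m)) * A) =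
      diagTrace n Λ (A * latX (fun _ => 1) (fun m => Polynomial.X - C (q m))) := by
  rw [diagTrace, diagTrace]
  simp only [entry_mul_latX_false, entry_mul_latX_true]
  exact congrArg₂ _ (sum_raise h1 h2 hA false) (sum_lower h1 h2 hq hA true)

theorem diagTrace_latY (h1 : ∀ j Q, Q.eval (q ((j : ℤ) + 1)) = 0 → Λ (j + 1) Q = Λ j Q)
    (h2 : ∀ Q, Λ n (taylor (-τ) Q) = Λ 0 Q)
    (hq : ∀ m, q (m + n) = q m + τ) (hA : A ∈ vermaSubmodule q n τ) :
    diagTrace n Λ (latY (fun _ => 1) (fun m => Polynomial.X - C (q m)) * A) =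
      diagTrace n Λ (A * latY (fun _ => 1) (fun m => Polynomial.X - C (q m))) := by
  have h := congrArg Neg.neg (sum_raise h1 h2 hA true)
  rw [← Finset.sum_neg_distrib, ← Finset.sum_neg_distrib] at h
  simp only [← map_neg] at h
  rw [diagTrace, diagTrace]
  simp only [entry_mul_latY_false, entry_mul_latY_true]
  exact congrArg₂ _ (sum_lower h1 h2 hq hA false) h

theorem diagTrace_diag {l : ℕ → ℂ} {κ : ℂ} (h3 : ∀ j z, Λ j (C z) = z * (κ + l j)) (u : ℂˣ) :
    diagTrace n Λ (latD 0 u) =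
      ∑ j ∈ Finset.range n, (((u ^ j : ℂˣ) : ℂ) + (((u⁻¹) ^ j : ℂˣ) : ℂ)) * (κ + l j) := by
  simp only [diagTrace, entry_latD, algebraMap_eq, and_self, if_true, mul_one, h3]
  rw [← Finset.sum_add_distrib]
  refine Finset.sum_congr rfl fun j _ => ?_
  simp [latExp, add_mul]

theorem diagTrace_diag_mul (u : ℂˣ) : diagTrace n Λ (latD 0 u * latH 0) = 0 := by
  simp [diagTrace, entry_mul_latH_false, entry_mul_latH_true, entry_latD]

/-- The trace of an element of the cyclic part on the weight modules with weights in `s + ℤ`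
diverges. As the diagonal entries are quasi-periodic polynomials in `s`, it can be replaced by a sum
over one period, in which each entry is evaluated by a functional on polynomials. -/
theorem exists_trace_diagonal {n : ℕ} (hn : 0 < n) (hn_even : Even n)
    {c : MonoidAlgebra ℂ (dicyclic n)}
    (hcent : c ∈ Subalgebra.center ℂ (MonoidAlgebra ℂ (dicyclic n)))
    (hc : ∀ γ : dicyclic n, c.coeff γ ≠ 0 → (γ : SL(2, ℂ)) ∈ Subgroup.zpowers (gMat n))
    (hc1 : c.coeff 1 ≠ 0) {l : ℕ → ℂ} (hl : l n = l 0) :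
    ∃ T ∈ traces (H (dicyclic n) c), ∃ κ : ℂ,
      (∀ (γ : dicyclic n) (u : ℂˣ), (γ : SL(2, ℂ)) = diagSL u →
        T ((universal (dicyclic n) c).grp γ) =
          ∑ j ∈ Finset.range n, (((u ^ j : ℂˣ) : ℂ) + (((u⁻¹) ^ j : ℂˣ) : ℂ)) * (κ + l j)) ∧
      ∀ (γ : dicyclic n) (u : ℂˣ), (γ : SL(2, ℂ)) = diagSL u * hMat →
        T ((universal (dicyclic n) c).grp γ) = 0 := by
  obtain ⟨q, hq⟩ := exists_potential (weight c)
  set τ : ℂ := n * c.coeff 1 with hτ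
  have hτ0 : τ ≠ 0 := mul_ne_zero (Nat.cast_ne_zero.2 hn.ne') hc1
  -- over a period the increments of `q` add up to `n c₁`
  have hqn : ∀ m, q (m + n) = q m + τ := by
    intro m
    have h := eq_of_step (f := fun m => q (m + n) - q m) (fun m => by
      have h1 := hq m
      have h2 := hq (m + n)
      rw [weight_add_period hn hc] at h2
      rw [show m + 1 + n = m + n + 1 by ring]
      linear_combination h2 - h1) m
    have h0 : q n - q 0 = τ := by
      rw [hτ, ← sum_weight hn hc]
      have := Finset.sum_range_sub (fun i : ℕ => q i) n
      rw [Nat.cast_zero] at this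
      rw [← this]
      exact Finset.sum_congr rfl fun i _ => by rw [← hq i]; push_cast; rfl
    simp only [zero_add] at h
    linear_combination h + h0
  obtain ⟨Λ, h1, h2, κ, h3⟩ := exists_functional_sequence hτ0 (fun j => q j) hl
  have h1' : ∀ j Q, Q.eval (q ((j : ℤ) + 1)) = 0 → Λ (j + 1) Q = Λ j Q := by
    intro j Q hQ
    exact h1 j Q (by exact_mod_cast hQ)
  obtain ⟨T, hT, hT'⟩ :=
    (latTorus (fun _ => 1) (fun m => Polynomial.X - C (q m) : ℤ → ℂ[X]) 0).exists_trace
    hn hn_even hc (latTorus_comm _ _ 0 hn hcent hc (fun m => by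
      rw [add_zero, ← hq m, map_sub]
      change 1 * (Polynomial.X - C (q m)) - (Polynomial.X - C (q (m + 1))) * 1 =
        C (q (m + 1)) - C (q m)
      ring)) (vermaSubmodule q n τ) one_mem_verma
    (fun w hw => latX_mul_mem_verma hqn hw) (fun w hw => latY_mul_mem_verma hqn hw)
    (fun u hu w hw => latD_mul_mem_verma hu hw) (fun w hw => latH_mul_mem_verma hn_even hw)
    (diagTrace n Λ)
    (fun w _ w' _ => by
      simp only [diagTrace, entry_add, map_add, Finset.sum_add_distrib]
      ring)
    (fun z w _ => by
      simp only [diagTrace, entry_smul, map_smul, smul_eq_mul, mul_add, Finset.mul_sum])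
    (fun w hw => diagTrace_latX h1' h2 hqn hw) (fun w hw => diagTrace_latY h1' h2 hqn hw)
    (fun u _ w _ => diagTrace_latD u w) (fun w _ => diagTrace_latH w)
  refine ⟨T, hT, κ, fun γ u h => ?_, fun γ u h => ?_⟩
  · rw [hT', h, TorusData.grpFun_diagSL]
    exact diagTrace_diag h3 u
  · rw [hT', h, TorusData.grpFun_diagSL_mul_hMat]
    exact diagTrace_diag_mul u

end Diagonal

/-! ### Counting -/

section Count

variable {n : ℕ} {c : MonoidAlgebra ℂ (dicyclic n)}

theorem sum_pow_of_pow_eq_one {u : ℂˣ} (hu : u ^ n = 1) :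
    ∑ j ∈ Finset.range n, ((u ^ j : ℂˣ) : ℂ) = if u = 1 then (n : ℂ) else 0 := by
  split_ifs with h
  · simp [h]
  · have h' : (u : ℂ) ≠ 1 := fun h' => h (Units.val_eq_one.1 h')
    simp only [Units.val_pow_eq_pow_val]
    rw [geom_sum_eq h', ← Units.val_pow_eq_pow_val, hu]
    simp

variable (n) in
/-- Representatives `g, …, g ^ (n / 2)` and `h, g h` of the conjugacy classes of nontrivial
elements. -/
def classRep : Fin (n / 2) ⊕ Fin 2 → dicyclic n :=
  Sum.elim (fun k => gElt n ^ (k + 1 : ℕ)) fun i => gElt n ^ (i : ℕ) * hElt n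

theorem gElt_pow_coe (k : ℕ) : ((gElt n ^ k : dicyclic n) : SL(2, ℂ)) = diagSL (epsUnit n ^ k) := by
  rw [map_pow, diagSL_epsUnit]
  rfl

theorem gElt_pow_mul_hElt_coe (k : ℕ) :
    ((gElt n ^ k * hElt n : dicyclic n) : SL(2, ℂ)) = diagSL (epsUnit n ^ k) * hMat := by
  rw [← gElt_pow_coe]
  rfl

theorem classRep_inl_coe (k : Fin (n / 2)) :
    (classRep n (Sum.inl k) : SL(2, ℂ)) = diagSL (epsUnit n ^ (k + 1 : ℕ)) := gElt_pow_coe _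

theorem classRep_inr_coe (i : Fin 2) :
    (classRep n (Sum.inr i) : SL(2, ℂ)) = diagSL (epsUnit n ^ (i : ℕ)) * hMat :=
  gElt_pow_mul_hElt_coe _

theorem trace_conj {T : H (dicyclic n) c →ₗ[ℂ] ℂ} (hT : T ∈ traces (H (dicyclic n) c))
    (γ δ : dicyclic n) : T ((universal (dicyclic n) c).grp (δ * γ * δ⁻¹)) =
      T ((universal (dicyclic n) c).grp γ) := by
  rw [map_mul, hT, ← map_mul, inv_mul_cancel_left]

/-- Every nontrivial element of the dicyclic group is conjugate to a representative. -/
theorem exists_conj_classRep (hn : 0 < n) (hn_even : Even n) {γ : dicyclic n} (hγ : γ ≠ 1) :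
    ∃ s δ, γ = δ * classRep n s * δ⁻¹ := by
  have hε := isPrimitiveRoot_epsUnit hn.ne'
  obtain ⟨a, ha, h | h⟩ := (mem_dicyclic_iff hn hn_even).1 γ.2
  · obtain ⟨k, hk, rfl⟩ := exists_epsUnit_pow hn ha
    rcases Nat.eq_zero_or_pos k with rfl | hk0
    · rw [pow_zero, map_one] at h
      exact absurd (Subtype.ext h) hγ
    rcases le_or_gt k (n / 2) with hk2 | hk2
    · refine ⟨Sum.inl ⟨k - 1, by omega⟩, 1, ?_⟩
      rw [one_mul, inv_one, mul_one]
      refine Subtype.ext ?_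
      rw [classRep_inl_coe, h, Nat.sub_add_cancel hk0]
    · have hev := Nat.div_add_mod n 2
      rw [Nat.even_iff.1 hn_even] at hev
      refine ⟨Sum.inl ⟨n - k - 1, by omega⟩, hElt n, ?_⟩
      rw [eq_mul_inv_iff_mul_eq]
      refine Subtype.ext ?_
      rw [Subgroup.coe_mul, Subgroup.coe_mul, classRep_inl_coe, h]
      change diagSL (epsUnit n ^ k) * hMat = hMat * _
      rw [hMat_mul_diagSL, ← inv_pow]
      congr 2
      rw [Nat.sub_add_cancel (by omega), inv_pow, eq_inv_iff_mul_eq_one, ← pow_add,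
        Nat.add_sub_cancel' hk.le, hε.pow_eq_one]
  · obtain ⟨k, hk, rfl⟩ := exists_epsUnit_pow hn ha
    refine ⟨Sum.inr ⟨k % 2, Nat.mod_lt _ two_pos⟩, gElt n ^ (k / 2), ?_⟩
    rw [eq_mul_inv_iff_mul_eq]
    refine Subtype.ext ?_
    rw [Subgroup.coe_mul, Subgroup.coe_mul, gElt_pow_coe, classRep_inr_coe, h, mul_assoc,
      hMat_mul_diagSL, ← mul_assoc, ← mul_assoc, ← map_mul, ← map_mul]
    congr 2
    rw [mul_inv_eq_iff_eq_mul, ← pow_add, ← pow_add]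
    congr 1
    change k = k / 2 + k % 2 + k / 2
    omega

variable (c) in
/-- The values of a trace on the representatives of the nontrivial conjugacy classes. -/
def traceValues : traces (H (dicyclic n) c) →ₗ[ℂ] (Fin (n / 2) ⊕ Fin 2 → ℂ) where
  toFun T s := T.1 ((universal (dicyclic n) c).grp (classRep n s))
  map_add' _ _ := rfl
  map_smul' _ _ := rfl

theorem traceValues_injective (hn : 0 < n) (hn_even : Even n) (hc1 : c.coeff 1 ≠ 0) :
    Function.Injective (traceValues c) := by
  rw [← LinearMap.ker_eq_bot, LinearMap.ker_eq_bot']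
  rintro ⟨T, hT⟩ h
  refine Subtype.ext (trace_eq_zero (det_one_sub_ne_zero hn hn_even) hc1 hT fun γ hγ => ?_)
  obtain ⟨s, δ, rfl⟩ := exists_conj_classRep hn hn_even hγ
  rw [trace_conj hT]
  exact congrFun h s

/-- For `Λ_j(1) = ε ^ (-(k + 1) j)`, up to a summand that does not matter, the trace of
`exists_trace_diagonal` vanishes at `g ^ (l + 1)` for `l ≠ k`, by orthogonality of characters. -/
theorem single_inl_mem_range (hn : 0 < n) (hn_even : Even n)
    (hcent : c ∈ Subalgebra.center ℂ (MonoidAlgebra ℂ (dicyclic n)))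
    (hc : ∀ γ : dicyclic n, c.coeff γ ≠ 0 → (γ : SL(2, ℂ)) ∈ Subgroup.zpowers (gMat n))
    (hc1 : c.coeff 1 ≠ 0) (k : Fin (n / 2)) :
    Pi.single (Sum.inl k) 1 ∈ LinearMap.range (traceValues c) := by
  have hε := isPrimitiveRoot_epsUnit hn.ne'
  set ε := epsUnit n
  set v := (ε ^ (k + 1 : ℕ))⁻¹ with hv
  have hpow : ∀ l : ℕ, (ε ^ l) ^ n = 1 := fun l => by
    rw [← pow_mul, mul_comm, pow_mul, hε.pow_eq_one, one_pow]
  have hvn : v ^ n = 1 := by rw [hv, inv_pow, hpow, inv_one]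
  obtain ⟨T, hT, κ, h1, h2⟩ := exists_trace_diagonal hn hn_even hcent hc hc1
    (l := fun j => ((v ^ j : ℂˣ) : ℂ)) (by rw [hvn, pow_zero])
  have hval : ∀ l : Fin (n / 2), T ((universal (dicyclic n) c).grp (classRep n (Sum.inl l))) =
      (if ε ^ (l + 1 : ℕ) * v = 1 then (n : ℂ) else 0) +
        if (ε ^ (l + 1 : ℕ))⁻¹ * v = 1 then (n : ℂ) else 0 := by
    intro l
    have hl1 : ε ^ (l + 1 : ℕ) ≠ 1 := hε.pow_ne_one_of_pos_of_lt (Nat.succ_ne_zero _) (by omega)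
    have hl := hpow (l + 1)
    set u := ε ^ (l + 1 : ℕ)
    have hli : u⁻¹ ^ n = 1 := by rw [inv_pow, hl, inv_one]
    rw [h1 _ u (classRep_inl_coe _)]
    have e : ∀ j : ℕ, (((u ^ j : ℂˣ) : ℂ) + (((u⁻¹) ^ j : ℂˣ) : ℂ)) * (κ + ((v ^ j : ℂˣ) : ℂ)) =
        κ * ((u ^ j : ℂˣ) : ℂ) + κ * (((u⁻¹) ^ j : ℂˣ) : ℂ) + (((u * v) ^ j : ℂˣ) : ℂ) +
          (((u⁻¹ * v) ^ j : ℂˣ) : ℂ) := by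
      intro j
      rw [mul_pow, mul_pow, Units.val_mul, Units.val_mul]
      ring
    simp only [e, Finset.sum_add_distrib, ← Finset.mul_sum]
    rw [sum_pow_of_pow_eq_one hl, sum_pow_of_pow_eq_one hli,
      sum_pow_of_pow_eq_one (by rw [mul_pow, hl, hvn, one_mul]),
      sum_pow_of_pow_eq_one (by rw [mul_pow, hli, hvn, one_mul]), if_neg hl1,
      if_neg (inv_ne_one.2 hl1)]
    ring
  have hn0 : (n : ℂ) ≠ 0 := Nat.cast_ne_zero.2 hn.ne'
  have hk0 : T ((universal (dicyclic n) c).grp (classRep n (Sum.inl k))) ≠ 0 := by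
    rw [hval, if_pos (mul_inv_cancel _)]
    -- the second summand is present exactly for the element `-1 = g ^ (n / 2)`
    split_ifs
    · rw [← two_mul]
      exact mul_ne_zero two_ne_zero hn0
    · rwa [add_zero]
  refine ⟨(T ((universal (dicyclic n) c).grp (classRep n (Sum.inl k))))⁻¹ • ⟨T, hT⟩, ?_⟩
  funext s
  rw [map_smul, Pi.smul_apply]
  change _ * T ((universal (dicyclic n) c).grp (classRep n s)) = _
  by_cases hs : s = Sum.inl k
  · rw [hs, Pi.single_eq_same, inv_mul_cancel₀ hk0]
  · rw [Pi.single_eq_of_ne hs]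
    rcases s with l | i
    · have hlk : (l : ℕ) ≠ k := fun h => hs (congrArg Sum.inl (Fin.ext h))
      rw [hval l, if_neg, if_neg, add_zero, mul_zero]
      · rw [hv, ← mul_inv, ← pow_add, inv_eq_one]
        exact hε.pow_ne_one_of_pos_of_lt (by omega) (by omega)
      · rw [hv, mul_inv_eq_one]
        intro h
        have := hε.pow_inj (by omega) (by omega) h
        omega
    · rw [h2 _ _ (classRep_inr_coe _), mul_zero]

/-- The traces of `exists_trace_antidiagonal` for `j₀ = 0` and `j₀ = n / 2` take the values `2, 2`
and `2, -2` at `h, g h`. -/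
theorem single_inr_mem_range (hn : 0 < n) (hn_even : Even n)
    (hcent : c ∈ Subalgebra.center ℂ (MonoidAlgebra ℂ (dicyclic n)))
    (hc : ∀ γ : dicyclic n, c.coeff γ ≠ 0 → (γ : SL(2, ℂ)) ∈ Subgroup.zpowers (gMat n))
    (i : Fin 2) : Pi.single (Sum.inr i) 1 ∈ LinearMap.range (traceValues c) := by
  obtain ⟨m, hm⟩ := hn_even
  have hε := isPrimitiveRoot_epsUnit hn.ne'
  have hpow : ∀ l : ℕ, (epsUnit n ^ l) ^ n = 1 := fun l => by
    rw [← pow_mul, mul_comm, pow_mul, hε.pow_eq_one, one_pow]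
  obtain ⟨T, hT, h1, h2⟩ := exists_trace_antidiagonal hn ⟨m, hm⟩ hcent hc (j₀ := 0) (by simp)
  obtain ⟨T', hT', h1', h2'⟩ := exists_trace_antidiagonal hn ⟨m, hm⟩ hcent hc (j₀ := m)
    ⟨1, by rw [hm]; push_cast; ring⟩
  have hεm : ((epsUnit n ^ m : ℂˣ) : ℂ) = -1 := by
    have h : IsPrimitiveRoot (epsUnit n ^ m) 2 := hε.pow hn (by omega)
    rw [← IsPrimitiveRoot.coe_units_iff] at h
    exact h.eq_neg_one_of_two_right
  refine ⟨(1 / 4 : ℂ) • ⟨T, hT⟩ + ((-1) ^ (i : ℕ) / 4 : ℂ) • ⟨T', hT'⟩, ?_⟩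
  funext s
  rw [map_add, map_smul, map_smul, Pi.add_apply, Pi.smul_apply, Pi.smul_apply]
  change _ * T ((universal (dicyclic n) c).grp (classRep n s)) +
    _ * T' ((universal (dicyclic n) c).grp (classRep n s)) = _
  rcases s with l | j
  · rw [h1 _ _ (classRep_inl_coe _), h1' _ _ (classRep_inl_coe _), Pi.single_eq_of_ne (by simp)]
    ring
  · rw [h2 _ _ (hpow _) (classRep_inr_coe _), h2' _ _ (hpow _) (classRep_inr_coe _),
      zpow_natCast, ← pow_mul, mul_comm (j : ℕ), pow_mul, Units.val_pow_eq_pow_val, hεm]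
    fin_cases i <;> fin_cases j <;> norm_num [Pi.single_apply]

theorem traceValues_surjective (hn : 0 < n) (hn_even : Even n)
    (hcent : c ∈ Subalgebra.center ℂ (MonoidAlgebra ℂ (dicyclic n)))
    (hc : ∀ γ : dicyclic n, c.coeff γ ≠ 0 → (γ : SL(2, ℂ)) ∈ Subgroup.zpowers (gMat n))
    (hc1 : c.coeff 1 ≠ 0) : Function.Surjective (traceValues c) := by
  rw [← LinearMap.range_eq_top, eq_top_iff, ← (Pi.basisFun ℂ _).span_eq, Submodule.span_le]
  rintro _ ⟨s, rfl⟩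
  rw [Pi.basisFun_apply]
  rcases s with k | i
  · exact single_inl_mem_range hn hn_even hcent hc hc1 k
  · exact single_inr_mem_range hn hn_even hcent hc i

end Count

end KleinianD

end

theorem mainTheorem5 (n : ℕ) (hn : 0 < n) (hn_even : Even n)
    (c : MonoidAlgebra ℂ (KleinianD.dicyclic n))
    (hc_center : c ∈ Subalgebra.center ℂ (MonoidAlgebra ℂ (KleinianD.dicyclic n)))
    (hc_cyclic : ∀ γ : KleinianD.dicyclic n, c.coeff γ ≠ 0 →
      (γ : Matrix.SpecialLinearGroup (Fin 2) ℂ) ∈ Subgroup.zpowers (KleinianD.gMat n))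
    (hc_one : c.coeff 1 ≠ 0) :
    Module.rank ℂ (KleinianD.traces (KleinianD.H (KleinianD.dicyclic n) c)) =
      ((n / 2 + 2 : ℕ) : Cardinal) := by
  rw [(LinearEquiv.ofBijective (KleinianD.traceValues c)
    ⟨KleinianD.traceValues_injective hn hn_even hc_one,
      KleinianD.traceValues_surjective hn hn_even hc_center hc_cyclic hc_one⟩).rank_eq, rank_fun']
  simp
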